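/- Let $N\ge 1$, let $\Omega\subseteq\mathbb R^N$ be open, and let all function spaces consist of complex-valued functions unless indicated. $H^{-1}(\Omega)$ is the topological dual of $H^1_0(\Omega)$, with the real duality product $\langle\cdot,\cdot\rangle_{H^{-1},H^1_0}\in\mathbb R$ that extends $\langle v,w\rangle_{L^2,L^2}=\operatorname{Re}\int_\Omega v\,\overline{w}\,dx$; in particular $\langle\Delta v,w\rangle_{H^{-1},H^1_0}=-\operatorname{Re}\int_\Omega\nabla v\cdot\overline{\nabla w}\,dx$ for $v,w\in H^1_0(\Omega)$. Let $f\colon H^1_0(\Omega)\to H^{-1}(\Omega)$ be continuous, with $\langle f(v),iav\rangle_{H^{-1},H^1_0}=0$ for every $a\in W^{1,\infty}(\Omega;\mathbb R)$ and every $v\in H^1_0(\Omega)$. Let $u_0\in H^1_0(\Omega)\setminus\{0\}$. Let $u\in L^\infty((0,\infty);H^1_0(\Omega))$ with $f(u)\in L^\infty((0,T);H^{-1}(\Omega))$ for every $T>0$, and suppose that $u$ is a weak solution of $iu_t+\Delta u+f(u)=0$ with Dirichlet boundary condition and $u(0)=u_0$, that is, for every $\varphi\in H^1_0(\Omega)$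 and every $\psi\in C_c^\infty((0,\infty);\mathbb R)$, $$\int_0^\infty\Bigl\{-\langle iu(t),\varphi\rangle_{L^2,L^2}\,\psi'(t)+\langle\Delta u(t)+f(u(t)),\varphi\rangle_{H^{-1},H^1_0}\,\psi(t)\Bigr\}\,dt=0,$$ and $u(t)\to u_0$ in $L^2(\Omega)$ as $t\to0^+$ (outside a null set of times). Then $u$ has a (unique) representative in $C([0,\infty);L^2(\Omega))$, again written $u$, and $u(0)=u_0$. Moreover, for every $0<\varepsilon<\|u_0\|_{L^2(\Omega)}$ the constant $$M_0=\frac{2\,\|u_0\|_{L^2(\Omega)}\,\|\nabla u\|_{L^\infty((0,\infty);L^2(\Omega))}}{\|u_0\|_{L^2(\Omega)}^2-\varepsilon^2}$$ is positive and, for every $r\in[2,\infty]$ and every $c\in\Omega$, $$\liminf_{t\to\infty}|t|^{N\left(\frac12-\frac1r\right)}\|u(t)\|_{L^r(\Omega\cap\{|x-c|<M_0|t|\})}\ \ge\ \varepsilon\,|B(0,M_0)|^{-\left(\frac12-\frac1r\right)},$$ where $B(0,M_0)\subset\mathbb R^N$ is the open ball, $|\cdot|$ of a set is Lebesgue measure,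 and an $L^r$ norm is $\infty$ if the function is not in $L^r$. The same holds for negative times: if $u\in L^\infty((-\infty,0);H^1_0(\Omega))$ is a solution on $(-\infty,0)$ in the same sense, with $f(u)\in L^\infty((-T,0);H^{-1}(\Omega))$ for every $T>0$ and $u(0)=u_0$, then all the conclusions hold with $(0,\infty)$, $[0,\infty)$ and $t\to\infty$ replaced by $(-\infty,0)$, $(-\infty,0]$ and $t\to-\infty$, including in the definition of $M_0$. -/

import Mathlib

open MeasureTheory Filter Topology Set
open scoped ENNReal ContDiff

noncomputable section

namespace NLS

/-- The space `ℝ^N` with its Euclidean norm and Lebesgue measure `volume`. -/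
abbrev Space (N : ℕ) : Type := EuclideanSpace ℝ (Fin N)

/-- `φ` is a test function on the open set `O`: smooth with compact support contained in `O`. -/
structure IsTest {E F : Type*} [NormedAddCommGroup E] [NormedSpace ℝ E]
    [NormedAddCommGroup F] [NormedSpace ℝ F] (O : Set E) (φ : E → F) : Prop where
  smooth : ContDiff ℝ ∞ φ
  compact : HasCompactSupport φ
  support : tsupport φ ⊆ O

/-- The partial derivative `∂φ/∂x_j` (used for smooth functions only). -/
def pderiv {N : ℕ} {F : Type*} [NormedAddCommGroup F] [NormedSpace ℝ F]
    (j : Fin N) (φ : Space N → F) (x : Space N) : F :=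
  fderiv ℝ φ x (EuclideanSpace.single j 1)

/-- The classical gradient of a complex-valued function (used for smooth functions only). -/
def cgrad {N : ℕ} (φ : Space N → ℂ) (x : Space N) : EuclideanSpace ℂ (Fin N) :=
  WithLp.toLp 2 fun j => pderiv j φ x

/-- `L²(Ω; ℂ)`. -/
abbrev L2 {N : ℕ} (Ω : Set (Space N)) : Type :=
  Lp ℂ 2 (volume.restrict Ω)

/-- `L²(Ω; ℂ^N)`, where `ℂ^N` has its Euclidean norm. -/
abbrev L2vec {N : ℕ} (Ω : Set (Space N)) : Type :=
  Lp (EuclideanSpace ℂ (Fin N)) 2 (volume.restrict Ω)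

/-- The Sobolev space `H¹₀(Ω; ℂ)`: the closure of the smooth compactly supported functions for
the norm `(‖u‖² + ‖∇u‖²)^{1/2}`. A function `u` is represented by the pair `(u, ∇u)` in the
Hilbert sum `L²(Ω; ℂ) ⊕ L²(Ω; ℂ^N)`, so that `H¹₀(Ω)` is the closure in this Hilbert space of the
set of all pairs `(φ, ∇φ)`, `φ` a test function. (This set is already a linear subspace. On its
closure the second component is the weak gradient of the first one, which determines it.) -/
def H10 {N : ℕ} (Ω : Set (Space N)) : Submodule ℂ (WithLp 2 (L2 Ω × L2vec Ω)) :=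
  (Submodule.span ℂ {p : WithLp 2 (L2 Ω × L2vec Ω) | ∃ φ : Space N → ℂ, IsTest Ω φ ∧
    (p.fst : Space N → ℂ) =ᵐ[volume.restrict Ω] φ ∧
    (p.snd : Space N → EuclideanSpace ℂ (Fin N)) =ᵐ[volume.restrict Ω] cgrad φ}).topologicalClosure

/-- An element of `H¹₀(Ω)` as an element of `L²(Ω)`. -/
def toL2 {N : ℕ} {Ω : Set (Space N)} (v : H10 Ω) : L2 Ω := (v : WithLp 2 (L2 Ω × L2vec Ω)).fst

/-- The gradient of an element of `H¹₀(Ω)`. -/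
def grad {N : ℕ} {Ω : Set (Space N)} (v : H10 Ω) : L2vec Ω :=
  (v : WithLp 2 (L2 Ω × L2vec Ω)).snd

/-- `H⁻¹(Ω)`, the topological dual of `H¹₀(Ω)`. The duality product takes real values, so this
is the space of continuous real-linear functionals, with the dual norm. -/
abbrev Hneg1 {N : ℕ} (Ω : Set (Space N)) : Type := StrongDual ℝ (H10 Ω)

/-- `a ∈ W^{1,∞}(Ω; ℝ)`: `a` is essentially bounded on `Ω` and has an essentially bounded weak
gradient `g` on `Ω`. -/
def MemW1inf {N : ℕ} (Ω : Set (Space N)) (a : Space N → ℝ) : Prop :=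
  MemLp a ∞ (volume.restrict Ω) ∧
  ∃ g : Space N → Space N, MemLp g ∞ (volume.restrict Ω) ∧
    ∀ φ : Space N → ℝ, IsTest Ω φ → ∀ j : Fin N,
      ∫ x in Ω, a x * pderiv j φ x = - ∫ x in Ω, g x j * φ x

/-- The condition `⟨f(u), i a u⟩ = 0` for all `a ∈ W^{1,∞}(Ω; ℝ)` and all `u ∈ H¹₀(Ω)`. Here `v`
is the element `i a u` of `H¹₀(Ω)`. -/
def IsGaugeOrthogonal {N : ℕ} {Ω : Set (Space N)} (f : H10 Ω → Hneg1 Ω) : Prop :=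
  ∀ a : Space N → ℝ, MemW1inf Ω a → ∀ u v : H10 Ω,
    (toL2 v : Space N → ℂ) =ᵐ[volume.restrict Ω] (fun x => Complex.I * (a x : ℂ) * toL2 u x) →
    f u v = 0

/-- The real duality product `⟨v, w⟩ = Re ∫_Ω v(x) conj(w(x)) dx` on `L²(Ω; ℂ)`. Mathlib's inner
product `inner ℂ w v` is `∫ conj(w) v`. -/
def pairL2 {N : ℕ} {Ω : Set (Space N)} (v w : L2 Ω) : ℝ := (inner ℂ w v).re

/-- `⟨Δv, w⟩ = - Re ∫_Ω ∇v · conj(∇w) dx`, the duality product of `Δv ∈ H⁻¹(Ω)` with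
`w ∈ H¹₀(Ω)`. -/
def pairLaplacian {N : ℕ} {Ω : Set (Space N)} (v w : H10 Ω) : ℝ :=
  - (inner ℂ (grad w) (grad v)).re

/-- `u ∈ L^∞(I; H¹₀(Ω))` is a solution on the time interval `I` (`(0,∞)` or `(-∞,0)`) of
`i u_t + Δu + f(u) = 0` with homogeneous Dirichlet boundary condition and `u(0) = u₀`.
Only the values of `u` on `I` matter, and only up to null sets. -/
structure IsSolution {N : ℕ} {Ω : Set (Space N)} (f : H10 Ω → Hneg1 Ω) (u₀ : H10 Ω)
    (I : Set ℝ) (u : ℝ → H10 Ω) : Prop where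
  /-- `u ∈ L^∞(I; H¹₀(Ω))`. -/
  bounded : MemLp u ∞ (volume.restrict I)
  /-- `f(u)` is (strongly measurable and) essentially bounded in `H⁻¹(Ω)` on `I ∩ (-T, T)`. -/
  nonlin_bounded : ∀ T : ℝ, 0 < T → MemLp (fun t => f (u t)) ∞ (volume.restrict (I ∩ Ioo (-T) T))
  /-- The equation in the sense of distributions in time with values in `H⁻¹(Ω)`. -/
  equation : ∀ φ : H10 Ω, ∀ ψ : ℝ → ℝ, IsTest I ψ →
    ∫ t in I, (- pairL2 (Complex.I • toL2 (u t)) (toL2 φ) * deriv ψ t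
      + (pairLaplacian (u t) φ + f (u t) φ) * ψ t) = 0
  /-- `u(0) = u₀`: `u(t)` tends to `u₀` in `L²(Ω)` as `t → 0` in `I`, outside a null set of `t`. -/
  initial : Tendsto (fun t => toL2 (u t)) (𝓝 0 ⊓ ae (volume.restrict I)) (𝓝 (toL2 u₀))

/-- `U` is the representative of `u` that is continuous from the closure of `I` to `L²(Ω)`. -/
def IsContRep {N : ℕ} {Ω : Set (Space N)} (I : Set ℝ) (u : ℝ → H10 Ω) (U : ℝ → L2 Ω) : Prop :=
  ContinuousOn U (closure I) ∧ U =ᵐ[volume.restrict I] fun t => toL2 (u t)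

/-- `‖∇u‖_{L^∞(I; L²(Ω))}` (finite if `u ∈ L^∞(I; H¹₀(Ω))`). -/
def gradSup {N : ℕ} {Ω : Set (Space N)} (I : Set ℝ) (u : ℝ → H10 Ω) : ℝ :=
  (eLpNorm (fun t => grad (u t)) ∞ (volume.restrict I)).toReal

/-- `M₀ = 2 ‖u₀‖ ‖∇u‖_{L^∞(I; L²)} / (‖u₀‖² - ε²)`, with `‖u₀‖` the norm in `L²(Ω)`. -/
def M0 {N : ℕ} {Ω : Set (Space N)} (u₀ : H10 Ω) (I : Set ℝ) (u : ℝ → H10 Ω) (ε : ℝ) : ℝ :=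
  2 * ‖toL2 u₀‖ * gradSup I u / (‖toL2 u₀‖ ^ 2 - ε ^ 2)

/-- The exponent `1/2 - 1/r`, with `1/∞ = 0`. -/
def expo (r : ℝ≥0∞) : ℝ := 1 / 2 - (r⁻¹).toReal

end NLS

end

namespace NLS

section RealVariable

lemma isTest_primitive {k : ℝ → ℝ} (hk : IsTest (Ioi (0 : ℝ)) k) (h0 : ∫ t, k t = 0) :
    IsTest (Ioi (0 : ℝ)) (fun t => ∫ s in (0 : ℝ)..t, k s) ∧
      deriv (fun t => ∫ s in (0 : ℝ)..t, k s) = k := by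
  have hcont := hk.smooth.continuous
  have hderiv : deriv (fun t => ∫ s in (0 : ℝ)..t, k s) = k := by
    ext t
    exact hcont.deriv_integral k 0 t
  have hint : Integrable k := hcont.integrable_of_hasCompactSupport hk.compact
  obtain ⟨α, hα0, hα⟩ : ∃ α : ℝ, 0 < α ∧ tsupport k ⊆ Ici α := by
    rcases (tsupport k).eq_empty_or_nonempty with he | hne
    · exact ⟨1, one_pos, by simp [he]⟩
    · obtain ⟨x, hx, hmin⟩ := hk.compact.isCompact.exists_isLeast hne
      exact ⟨x, hk.support hx, fun y hy => hmin hy⟩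
  obtain ⟨β, hβ⟩ : ∃ β : ℝ, tsupport k ⊆ Iic β := by
    obtain ⟨β, hβ⟩ := hk.compact.isCompact.bddAbove
    exact ⟨β, fun y hy => hβ hy⟩
  have hzero : ∀ t, t ∉ tsupport k → k t = 0 := fun t ht => image_eq_zero_of_notMem_tsupport ht
  have hsupp : Function.support (fun t => ∫ s in (0 : ℝ)..t, k s) ⊆ Icc α β := by
    intro t ht
    by_contra hcon
    apply ht
    by_cases h1 : t < α
    · apply intervalIntegral.integral_zero_ae
      refine Eventually.of_forall fun s hs => hzero s fun hs' => ?_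
      have h2 := hα hs'
      rw [mem_Ici] at h2
      rcases le_total 0 t with h3 | h3
      · rw [uIoc_of_le h3] at hs; linarith [hs.2]
      · rw [uIoc_of_ge h3] at hs; linarith [hs.2]
    · have h2 : β < t := by
        by_contra h3
        exact hcon ⟨not_lt.1 h1, not_lt.1 h3⟩
      have h4 : 0 ≤ t := hα0.le.trans (not_lt.1 h1)
      change ∫ s in (0 : ℝ)..t, k s = 0
      rw [intervalIntegral.integral_of_le h4,
        setIntegral_eq_integral_of_forall_compl_eq_zero fun s hs => ?_, h0]
      refine hzero s fun hs' => hs ⟨hk.support hs', ?_⟩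
      exact (hβ hs').trans h2.le
  have hts : tsupport (fun t => ∫ s in (0 : ℝ)..t, k s) ⊆ Icc α β :=
    closure_minimal hsupp isClosed_Icc
  refine ⟨⟨?_, ?_, ?_⟩, hderiv⟩
  · rw [contDiff_infty_iff_deriv, hderiv]
    exact ⟨fun t => (hcont.integral_hasStrictDerivAt 0 t).hasDerivAt.differentiableAt, hk.smooth⟩
  · exact HasCompactSupport.intro isCompact_Icc fun x hx => by
      by_contra h
      exact hx (hsupp h)
  · exact fun x hx => lt_of_lt_of_le hα0 (hts hx).1

/-- The du Bois-Reymond lemma on `(0, ∞)`. -/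
lemma ae_eq_const_of_integral_deriv_smul_eq_zero {E : Type*} [NormedAddCommGroup E]
    [NormedSpace ℝ E] [CompleteSpace E] {W : ℝ → E} (hW : LocallyIntegrable W)
    (h : ∀ ψ : ℝ → ℝ, IsTest (Ioi (0 : ℝ)) ψ → ∫ t, deriv ψ t • W t = 0) :
    ∃ c : E, ∀ᵐ t, t ∈ Ioi (0 : ℝ) → W t = c := by
  let b : ContDiffBump (2 : ℝ) := ⟨1 / 2, 1, by norm_num, by norm_num⟩
  let ρ : ℝ → ℝ := b.normed volume
  have hρs : ContDiff ℝ ∞ ρ := b.contDiff_normed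
  have hρc : HasCompactSupport ρ := b.hasCompactSupport_normed
  have hρt : tsupport ρ ⊆ Ioi 0 := by
    change tsupport (b.normed volume) ⊆ _
    rw [b.tsupport_normed_eq]
    intro x hx
    rw [Metric.mem_closedBall, Real.dist_eq, abs_le] at hx
    have : b.rOut = 1 := rfl
    rw [mem_Ioi]
    linarith [hx.1]
  have hρ1 : ∫ t, ρ t = 1 := b.integral_normed
  have hint : ∀ g : ℝ → ℝ, Continuous g → HasCompactSupport g → Integrable fun t => g t • W t :=
    fun g hg hc => hW.integrable_smul_left_of_hasCompactSupport hg hc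
  refine ⟨∫ t, ρ t • W t, ?_⟩
  have key := isOpen_Ioi.ae_eq_zero_of_integral_contDiff_smul_eq_zero
    (f := fun t => W t - ∫ t, ρ t • W t) (U := Ioi (0 : ℝ)) (μ := volume)
    ((hW.sub (locallyIntegrable_const _)).locallyIntegrableOn _) (fun g hg hgc hgt => ?_)
  · filter_upwards [key] with t ht h0
    exact sub_eq_zero.1 (ht h0)
  · let k : ℝ → ℝ := fun t => g t - (∫ s, g s) * ρ t
    have hgi : Integrable g := hg.continuous.integrable_of_hasCompactSupport hgc
    have hρi : Integrable ρ := hρs.continuous.integrable_of_hasCompactSupport hρc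
    have hk : IsTest (Ioi (0 : ℝ)) k := by
      refine ⟨hg.sub (contDiff_const.mul hρs), hgc.sub hρc.mul_left, ?_⟩
      refine (tsupport_sub _ _).trans (union_subset hgt ?_)
      exact (tsupport_mul_subset_right).trans hρt
    have hk0 : ∫ t, k t = 0 := by
      change ∫ t, (g t - (∫ s, g s) * ρ t) = 0
      rw [integral_sub hgi (hρi.const_mul _), integral_const_mul, hρ1]
      ring
    obtain ⟨h1, h2⟩ := isTest_primitive hk hk0
    have h3 := h _ h1
    rw [h2] at h3
    have h4 : ∀ t, k t • W t = g t • W t - (∫ s, g s) • ρ t • W t := fun t => by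
      simp only [k, sub_smul, mul_smul]
    simp_rw [h4] at h3
    rw [integral_sub (hint g hg.continuous hgc)
      ((hint ρ hρs.continuous hρc).smul (∫ s, g s) : Integrable fun t => (∫ s, g s) • ρ t • W t),
      integral_smul] at h3
    simp_rw [smul_sub]
    rw [integral_sub (hint g hg.continuous hgc) (hgi.smul_const _), integral_smul_const, h3]

lemma integral_deriv_mul_primitive {g ψ : ℝ → ℝ} (hg : LocallyIntegrable g)
    (hψ : ContDiff ℝ ∞ ψ) (hc : HasCompactSupport ψ) :
    ∫ t, deriv ψ t * ∫ s in (0 : ℝ)..t, g s = - ∫ t, ψ t * g t := by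
  obtain ⟨R, hR⟩ := hc.isCompact.isBounded.subset_closedBall (0 : ℝ)
  set M : ℝ := |R| + 1 with hM
  have hM0 : 0 < M := by positivity
  have hout : ∀ t, t ∉ Ioo (-M) M → t ∉ tsupport ψ := by
    intro t ht hts
    have := hR hts
    rw [Metric.mem_closedBall, Real.dist_eq, sub_zero] at this
    exact ht ⟨by linarith [neg_abs_le t, le_abs_self R], by linarith [le_abs_self t, le_abs_self R]⟩
  have hψ0 : ∀ t, t ∉ Ioo (-M) M → ψ t = 0 := fun t ht => image_eq_zero_of_notMem_tsupport (hout t ht)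
  have hdψ0 : ∀ t, t ∉ Ioo (-M) M → deriv ψ t = 0 := fun t ht =>
    image_eq_zero_of_notMem_tsupport fun h => hout t ht (tsupport_deriv_subset h)
  have hgi : IntervalIntegrable g volume (-M) M :=
    (hg.integrableOn_isCompact isCompact_uIcc).mono_set uIoc_subset_uIcc |> intervalIntegrable_iff.2
  have hac1 : AbsolutelyContinuousOnInterval (fun t => ∫ s in (0 : ℝ)..t, g s) (-M) M :=
    hgi.absolutelyContinuousOnInterval_intervalIntegral
      (by rw [uIcc_of_le (by linarith)]; constructor <;> linarith)
  have hac2 : AbsolutelyContinuousOnInterval ψ (-M) M :=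
    (hψ.of_le (by exact_mod_cast le_top)).contDiffOn.absolutelyContinuousOnInterval
  have hibp := hac2.integral_mul_deriv_eq_deriv_mul hac1
  rw [hψ0 M (by simp), hψ0 (-M) (by simp)] at hibp
  have e1 : ∫ t, deriv ψ t * ∫ s in (0 : ℝ)..t, g s =
      ∫ t in (-M)..M, deriv ψ t * ∫ s in (0 : ℝ)..t, g s := by
    rw [intervalIntegral.integral_of_le (by linarith)]
    refine (setIntegral_eq_integral_of_forall_compl_eq_zero fun t ht => ?_).symm
    rw [hdψ0 t fun h => ht ⟨h.1, h.2.le⟩, zero_mul]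
  have e2 : ∫ t, ψ t * g t = ∫ t in (-M)..M, ψ t * deriv (fun t => ∫ s in (0 : ℝ)..t, g s) t := by
    rw [intervalIntegral.integral_of_le (by linarith)]
    rw [← setIntegral_eq_integral_of_forall_compl_eq_zero (s := Ioc (-M) M) fun t ht => by
      rw [hψ0 t fun h => ht ⟨h.1, h.2.le⟩, zero_mul]]
    apply integral_congr_ae
    filter_upwards [ae_restrict_of_ae (_root_.LocallyIntegrable.ae_hasDerivAt_integral hg)] with t ht
    rw [(ht 0).deriv]
  rw [e1, e2, hibp]
  ring

end RealVariable

section Primitive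

lemma locallyIntegrable_indicator_of_memLp {E : Type*} [NormedAddCommGroup E] {G : ℝ → E}
    (hG : ∀ T : ℝ, 0 < T → MemLp G ∞ (volume.restrict (Ioo 0 T))) :
    LocallyIntegrable ((Ioi (0 : ℝ)).indicator G) := by
  refine fun x => ⟨Iio (|x| + 1), Iio_mem_nhds (by linarith [le_abs_self x]), ?_⟩
  have h1 : IntegrableOn G (Ioo 0 (|x| + 1)) :=
    memLp_one_iff_integrable.1 ((hG (|x| + 1) (by positivity)).mono_exponent le_top)
  rw [IntegrableOn, integrable_indicator_iff measurableSet_Ioi, IntegrableOn,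
    Measure.restrict_restrict measurableSet_Ioi]
  exact h1

variable {E : Type*} [NormedAddCommGroup E] [NormedSpace ℝ E] {G : ℝ → E}

/-- The primitive of the extension by zero of `G` from `(0, ∞)`. -/
noncomputable def prim {E : Type*} [NormedAddCommGroup E] [NormedSpace ℝ E]
    (G : ℝ → E) (t : ℝ) : E :=
  ∫ s in (0 : ℝ)..t, (Ioi (0 : ℝ)).indicator G s

lemma exists_norm_prim_sub_le (hG : ∀ T : ℝ, 0 < T → MemLp G ∞ (volume.restrict (Ioo 0 T)))
    {T : ℝ} (hT : 0 < T) :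
    ∃ C : ℝ, 0 ≤ C ∧ ∀ s ∈ Icc 0 T, ∀ t ∈ Icc 0 T, ‖prim G t - prim G s‖ ≤ C * |t - s| := by
  have hloc := locallyIntegrable_indicator_of_memLp hG
  have hii : ∀ a b, IntervalIntegrable ((Ioi (0 : ℝ)).indicator G) volume a b := fun a b =>
    intervalIntegrable_iff.2
      ((hloc.integrableOn_isCompact isCompact_uIcc).mono_set uIoc_subset_uIcc)
  set C := (eLpNorm G ∞ (volume.restrict (Ioo 0 T))).toReal with hC
  have hb : ∀ᵐ t ∂(volume.restrict (Ioo 0 T)), ‖G t‖ ≤ C := by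
    have h1 := (hG T hT).2.ne
    filter_upwards [ae_le_eLpNormEssSup (f := G) (μ := volume.restrict (Ioo 0 T))] with t ht
    rw [hC, ← toReal_enorm]
    exact ENNReal.toReal_mono h1 (by simpa [eLpNorm_exponent_top] using ht)
  rw [ae_restrict_iff' measurableSet_Ioo] at hb
  refine ⟨C, ENNReal.toReal_nonneg, fun s hs t ht => ?_⟩
  rw [prim, prim, intervalIntegral.integral_interval_sub_left (hii _ _) (hii _ _)]
  have hT' : ∀ᵐ t : ℝ, t ≠ T := by simp [ae_iff]
  refine intervalIntegral.norm_integral_le_of_norm_le_const_ae ?_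
  filter_upwards [hb, hT'] with x hx hxT hmem
  have hx1 : x ∈ Ioc 0 T := by
    rcases le_total s t with h | h
    · rw [uIoc_of_le h] at hmem; exact ⟨by linarith [hmem.1, hs.1], by linarith [hmem.2, ht.2]⟩
    · rw [uIoc_of_ge h] at hmem; exact ⟨by linarith [hmem.1, ht.1], by linarith [hmem.2, hs.2]⟩
  rw [indicator_of_mem (show x ∈ Ioi 0 from hx1.1)]
  exact hx ⟨hx1.1, lt_of_le_of_ne hx1.2 hxT⟩

lemma continuous_prim (hG : ∀ T : ℝ, 0 < T → MemLp G ∞ (volume.restrict (Ioo 0 T))) :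
    Continuous (prim G) := by
  have hloc := locallyIntegrable_indicator_of_memLp hG
  exact intervalIntegral.continuous_primitive (fun a b =>
    intervalIntegrable_iff.2
      ((hloc.integrableOn_isCompact isCompact_uIcc).mono_set uIoc_subset_uIcc)) 0

lemma prim_apply {H : Type*} [NormedAddCommGroup H] [NormedSpace ℝ H] {G : ℝ → StrongDual ℝ H}
    (hG : ∀ T : ℝ, 0 < T → MemLp G ∞ (volume.restrict (Ioo 0 T))) (t : ℝ) (φ : H) :
    prim G t φ = ∫ s in (0 : ℝ)..t, (Ioi (0 : ℝ)).indicator G s φ := by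
  have hloc := locallyIntegrable_indicator_of_memLp hG
  exact ContinuousLinearMap.intervalIntegral_apply (intervalIntegrable_iff.2
    ((hloc.integrableOn_isCompact isCompact_uIcc).mono_set uIoc_subset_uIcc)) φ

lemma neBot_nhds_zero_inf_ae :
    (𝓝 (0 : ℝ) ⊓ ae (volume.restrict (Ioi (0 : ℝ)))).NeBot := by
  rw [inf_neBot_iff_frequently_left]
  intro p hp
  obtain ⟨ε, hε, hball⟩ := Metric.eventually_nhds_iff.1 hp
  intro hcon
  rw [ae_restrict_iff' measurableSet_Ioi] at hcon
  have h0 : volume (Ioo (0 : ℝ) ε) = 0 := by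
    refine measure_mono_null (fun t ht => ?_) (ae_iff.1 hcon)
    simp only [mem_ofPred_eq, Classical.not_imp, not_not]
    exact ⟨ht.1, hball (by rw [Real.dist_eq, sub_zero, abs_of_pos ht.1]; exact ht.2)⟩
  simp [hε.not_ge] at h0

end Primitive

section Evolution

variable {H L : Type*} [NormedAddCommGroup H] [InnerProductSpace ℂ H]
  [NormedSpace ℝ H] [IsScalarTower ℝ ℂ H]
  [NormedAddCommGroup L] [InnerProductSpace ℂ L] 

/-- The functional `φ ↦ Re ⟨y, A φ⟩` on `H`, as an additive function of `y ∈ L`. -/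
noncomputable def dualEmb (A : H →L[ℂ] L) (y : L) : StrongDual ℝ H :=
  Complex.reCLM.comp (((innerSL ℂ y).comp A).restrictScalars ℝ)

lemma dualEmb_apply (A : H →L[ℂ] L) (y : L) (φ : H) : dualEmb A y φ = (inner ℂ y (A φ)).re := rfl

lemma dualEmb_sub (A : H →L[ℂ] L) (y z : L) : dualEmb A (y - z) = dualEmb A y - dualEmb A z := by
  ext φ
  simp [dualEmb_apply]

lemma norm_dualEmb_le (A : H →L[ℂ] L) (y : L) : ‖dualEmb A y‖ ≤ ‖A‖ * ‖y‖ := by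
  refine ContinuousLinearMap.opNorm_le_bound _ (by positivity) fun φ => ?_
  rw [dualEmb_apply, Real.norm_eq_abs]
  calc _ ≤ ‖inner ℂ y (A φ)‖ := Complex.abs_re_le_norm _
    _ ≤ ‖y‖ * ‖A φ‖ := norm_inner_le_norm _ _
    _ ≤ ‖y‖ * (‖A‖ * ‖φ‖) := by gcongr; exact A.le_opNorm _
    _ = _ := by ring

lemma continuous_dualEmb (A : H →L[ℂ] L) : Continuous (dualEmb A) := by
  have : LipschitzWith ‖A‖₊ (dualEmb A) := LipschitzWith.of_dist_le_mul fun y z => by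
    rw [dist_eq_norm, dist_eq_norm, ← dualEmb_sub]
    exact norm_dualEmb_le A _
  exact this.continuous

/-- `v` is a bounded weak solution on `(0, ∞)` of `σ i v_t + G = 0` with initial value `y₀`, in
the dual of `H`, where `A` embeds `H` into the pivot space `L`. -/
structure IsWeakSolution (A : H →L[ℂ] L) (σ : ℝ) (y₀ : L) (v : ℝ → H)
    (G : ℝ → StrongDual ℝ H) : Prop where
  bounded : MemLp v ∞ (volume.restrict (Ioi (0 : ℝ)))
  force : ∀ T : ℝ, 0 < T → MemLp G ∞ (volume.restrict (Ioo 0 T))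
  equation : ∀ φ : H, ∀ ψ : ℝ → ℝ, IsTest (Ioi (0 : ℝ)) ψ →
    ∫ t in Ioi (0 : ℝ), (- (σ * dualEmb A (Complex.I • A (v t)) φ) * deriv ψ t + G t φ * ψ t) = 0
  initial : Tendsto (fun t => A (v t)) (𝓝 0 ⊓ ae (volume.restrict (Ioi (0 : ℝ)))) (𝓝 y₀)

variable {A : H →L[ℂ] L} {σ : ℝ} {y₀ : L} {v : ℝ → H} {G : ℝ → StrongDual ℝ H}

/-- The weak equation integrated in time. -/
lemma IsWeakSolution.ae_integrated (h : IsWeakSolution A σ y₀ v G) :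
    ∀ᵐ t, t ∈ Ioi (0 : ℝ) → σ • dualEmb A (Complex.I • A (v t)) =
      σ • dualEmb A (Complex.I • y₀) - prim G t := by
  have hloc := locallyIntegrable_indicator_of_memLp h.force
  let w : ℝ → StrongDual ℝ H := fun t => σ • dualEmb A (Complex.I • A (v t))
  have hcw : Continuous fun x : H => σ • dualEmb A (Complex.I • A x) :=
    ((continuous_dualEmb A).comp (A.continuous.const_smul _)).const_smul σ
  have hwm : AEStronglyMeasurable w (volume.restrict (Ioi 0)) :=
    hcw.comp_aestronglyMeasurable h.bounded.1
  have hwb : MemLp w ∞ (volume.restrict (Ioi 0)) := by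
    refine h.bounded.of_le_mul (c := |σ| * (‖A‖ * ‖A‖)) hwm (Eventually.of_forall fun t => ?_)
    calc ‖w t‖ = |σ| * ‖dualEmb A (Complex.I • A (v t))‖ := by
          rw [norm_smul, Real.norm_eq_abs]
      _ ≤ |σ| * (‖A‖ * (‖A‖ * ‖v t‖)) := by
          gcongr
          refine (norm_dualEmb_le A _).trans ?_
          gcongr
          rw [norm_smul, Complex.norm_I, one_mul]
          exact A.le_opNorm _
      _ = _ := by ring
  have hwloc : LocallyIntegrable ((Ioi (0 : ℝ)).indicator w) :=
    locallyIntegrable_indicator_of_memLp fun T _ =>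
      hwb.mono_measure (Measure.restrict_mono Ioo_subset_Ioi_self le_rfl)
  let W : ℝ → StrongDual ℝ H := fun t => (Ioi (0 : ℝ)).indicator w t + prim G t
  have hW : LocallyIntegrable W := hwloc.add (continuous_prim h.force).locallyIntegrable
  obtain ⟨c, hc⟩ := ae_eq_const_of_integral_deriv_smul_eq_zero hW fun ψ hψ => by
    have hdc : Continuous (deriv ψ) := hψ.smooth.continuous_deriv (by exact_mod_cast le_top)
    have hdi : HasCompactSupport (deriv ψ) := hψ.compact.deriv
    have i1 := hW.integrable_smul_left_of_hasCompactSupport hdc hdi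
    ext φ
    rw [ContinuousLinearMap.integral_apply i1]
    have i2 : Integrable fun t => deriv ψ t * (Ioi (0 : ℝ)).indicator w t φ :=
      ((ContinuousLinearMap.apply ℝ ℝ φ).integrable_comp
        (hwloc.integrable_smul_left_of_hasCompactSupport hdc hdi))
    have i3 : Integrable fun t => deriv ψ t * prim G t φ :=
      ((ContinuousLinearMap.apply ℝ ℝ φ).integrable_comp
        ((continuous_prim h.force).locallyIntegrable.integrable_smul_left_of_hasCompactSupport
          hdc hdi))
    have i4 : Integrable fun t => ψ t * (Ioi (0 : ℝ)).indicator G t φ :=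
      ((ContinuousLinearMap.apply ℝ ℝ φ).integrable_comp
        (hloc.integrable_smul_left_of_hasCompactSupport hψ.smooth.continuous hψ.compact))
    have hloc' : LocallyIntegrable fun t => (Ioi (0 : ℝ)).indicator G t φ := fun x => by
      obtain ⟨s, hs, hi⟩ := hloc x
      exact ⟨s, hs, (ContinuousLinearMap.apply ℝ ℝ φ).integrable_comp hi⟩
    have e := h.equation φ ψ hψ
    have e1 : ∫ t in Ioi (0 : ℝ),
        (- (σ * dualEmb A (Complex.I • A (v t)) φ) * deriv ψ t + G t φ * ψ t) =
        ∫ t, (- (deriv ψ t * (Ioi (0 : ℝ)).indicator w t φ)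
          + ψ t * (Ioi (0 : ℝ)).indicator G t φ) := by
      rw [← integral_indicator measurableSet_Ioi]
      congr 1
      ext t
      by_cases ht : t ∈ Ioi (0 : ℝ)
      · simp only [indicator_of_mem ht, w, smul_apply, smul_eq_mul]
        ring
      · simp [indicator_of_notMem ht]
    have i2n : Integrable fun t => - (deriv ψ t * (Ioi (0 : ℝ)).indicator w t φ) := i2.neg
    rw [e1, integral_add i2n i4, integral_neg] at e
    have e2 := integral_deriv_mul_primitive hloc' hψ.smooth hψ.compact
    simp_rw [← prim_apply h.force] at e2
    change ∫ t, (deriv ψ t • W t) φ = 0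
    have e3 : ∀ t, (deriv ψ t • W t) φ =
        deriv ψ t * (Ioi (0 : ℝ)).indicator w t φ + deriv ψ t * prim G t φ := fun t => by
      simp [W]
    simp_rw [e3]
    rw [integral_add i2 i3, e2]
    linarith
  have hne := neBot_nhds_zero_inf_ae
  have hlim1 : Tendsto W (𝓝 0 ⊓ ae (volume.restrict (Ioi (0 : ℝ)))) (𝓝 c) := by
    refine tendsto_const_nhds.congr' ?_
    refine Filter.EventuallyEq.filter_mono ?_ inf_le_right
    rw [EventuallyEq, ae_restrict_iff' measurableSet_Ioi]
    filter_upwards [hc] with t ht h0 using (ht h0).symm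
  have hlim2 : Tendsto W (𝓝 0 ⊓ ae (volume.restrict (Ioi (0 : ℝ))))
      (𝓝 (σ • dualEmb A (Complex.I • y₀) + prim G 0)) := by
    refine Tendsto.add ?_ (((continuous_prim h.force).tendsto 0).mono_left inf_le_left)
    have := ((continuous_dualEmb A).comp (continuous_const_smul Complex.I)).const_smul σ
    refine ((this.tendsto y₀).comp h.initial).congr' ?_
    refine Filter.EventuallyEq.filter_mono ?_ inf_le_right
    rw [EventuallyEq, ae_restrict_iff' measurableSet_Ioi]
    filter_upwards with t ht
    simp [indicator_of_mem ht, w]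
  have hceq := tendsto_nhds_unique hlim1 hlim2
  have hp0 : prim G 0 = 0 := by simp [prim]
  rw [hp0, add_zero] at hceq
  filter_upwards [hc] with t ht h0
  have := ht h0
  simp only [W, indicator_of_mem h0] at this
  rw [← hceq, ← this]
  simp [w]

end Evolution

lemma closure_subset_closure_inter_of_ae {O E : Set ℝ} (hO : IsOpen O)
    (h : ∀ᵐ t, t ∈ O → t ∈ E) : closure O ⊆ closure (E ∩ O) := by
  refine closure_minimal (fun x hx => ?_) isClosed_closure
  rw [mem_closure_iff]
  intro o ho hxo
  by_contra hcon
  rw [not_nonempty_iff_eq_empty] at hcon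
  have hpos : 0 < volume (o ∩ O) := (ho.inter hO).measure_pos volume ⟨x, hxo, hx⟩
  refine hpos.ne' (measure_mono_null (fun t ht => ?_) (ae_iff.1 h))
  simp only [mem_ofPred_eq, Classical.not_imp]
  exact ⟨ht.2, fun hE => (hcon ▸ (⟨ht.1, hE, ht.2⟩ : t ∈ o ∩ (E ∩ O)) : t ∈ (∅ : Set ℝ))⟩

lemma eq_of_continuousOn_of_tendsto {L : Type*} [TopologicalSpace L] [T2Space L] {U w : ℝ → L}
    {y : L} (hU : ContinuousOn U (Ici 0)) (hUw : U =ᵐ[volume.restrict (Ioi 0)] w)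
    (hw : Tendsto w (𝓝 0 ⊓ ae (volume.restrict (Ioi (0 : ℝ)))) (𝓝 y)) : U 0 = y := by
  have hne := neBot_nhds_zero_inf_ae
  have h1 : Tendsto U (𝓝 0 ⊓ ae (volume.restrict (Ioi (0 : ℝ)))) (𝓝 y) :=
    hw.congr' (EventuallyEq.filter_mono hUw.symm inf_le_right)
  refine tendsto_nhds_unique (Tendsto.mono_left (hU 0 self_mem_Ici) ?_) h1
  refine le_inf inf_le_left (inf_le_right.trans (le_principal_iff.2 ?_))
  filter_upwards [ae_restrict_mem measurableSet_Ioi] with t ht using mem_Ici.2 (mem_Ioi.1 ht).le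

section Evolution

variable {H L : Type*} [NormedAddCommGroup H] [InnerProductSpace ℂ H]
  [NormedSpace ℝ H] [IsScalarTower ℝ ℂ H]
  [NormedAddCommGroup L] [InnerProductSpace ℂ L]

/-- Bounded nets in `H` whose image under an injective operator converges strongly converge
weakly. -/
lemma tendsto_dual_apply_of_injective [CompleteSpace H] [CompleteSpace L] {A : H →L[ℂ] L}
    (hA : Function.Injective A) {ι : Type*} {l : Filter ι} {w : ι → H} {w₀ : H} {K : ℝ}
    (hK : ∀ᶠ i in l, ‖w i‖ ≤ K) (hw : Tendsto (fun i => A (w i)) l (𝓝 (A w₀)))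
    (ℓ : StrongDual ℝ H) : Tendsto (fun i => ℓ (w i)) l (𝓝 (ℓ w₀)) := by
  let a : H := (InnerProductSpace.toDual ℂ H).symm (StrongDual.extendRCLike (𝕜 := ℂ) ℓ)
  have ha : ∀ x, ℓ x = (inner ℂ a x).re := fun x => by
    rw [InnerProductSpace.toDual_symm_apply]
    have := StrongDual.extendRCLike_apply (𝕜 := ℂ) ℓ x
    rw [this]
    simp
  have hdense : a ∈ closure (range (ContinuousLinearMap.adjoint A)) := by
    have h1 := ContinuousLinearMap.orthogonal_ker A
    have h2 : (A : H →ₗ[ℂ] L).ker = ⊥ := LinearMap.ker_eq_bot.2 hA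
    rw [h2, Submodule.bot_orthogonal_eq_top] at h1
    have : a ∈ ((ContinuousLinearMap.adjoint A : L →L[ℂ] H) :
      L →ₗ[ℂ] H).range.topologicalClosure := h1 ▸ Submodule.mem_top
    rw [← SetLike.mem_coe, Submodule.topologicalClosure_coe] at this
    exact this
  rw [Metric.tendsto_nhds]
  intro ε hε
  set K' := |K| + ‖w₀‖ + 1 with hK'
  have hK'0 : 0 < K' := by positivity
  obtain ⟨_, ⟨y, rfl⟩, hy⟩ := Metric.mem_closure_iff.1 hdense (ε / (2 * K')) (by positivity)
  have h3 : Tendsto (fun i => ‖y‖ * ‖A (w i) - A w₀‖) l (𝓝 0) := by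
    simpa using (tendsto_iff_norm_sub_tendsto_zero.1 hw).const_mul ‖y‖
  filter_upwards [hK, h3.eventually (gt_mem_nhds (half_pos hε))] with i hi1 hi2
  rw [Real.dist_eq, ← map_sub, ha]
  have h4 : inner ℂ a (w i - w₀) = inner ℂ (a - ContinuousLinearMap.adjoint A y) (w i - w₀)
      + inner ℂ y (A (w i) - A w₀) := by
    rw [inner_sub_left, ContinuousLinearMap.adjoint_inner_left, map_sub]
    ring
  have h5 : ‖w i - w₀‖ ≤ K' := by
    have := norm_sub_le (w i) w₀
    have := le_abs_self K
    linarith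
  rw [dist_eq_norm] at hy
  calc |(inner ℂ a (w i - w₀)).re| ≤ ‖inner ℂ a (w i - w₀)‖ := Complex.abs_re_le_norm _
    _ ≤ ‖a - ContinuousLinearMap.adjoint A y‖ * ‖w i - w₀‖ + ‖y‖ * ‖A (w i) - A w₀‖ := by
        rw [h4]
        exact (norm_add_le _ _).trans (add_le_add (norm_inner_le_norm _ _) (norm_inner_le_norm _ _))
    _ ≤ ε / (2 * K') * K' + ‖y‖ * ‖A (w i) - A w₀‖ := by gcongr
    _ < ε / (2 * K') * K' + ε / 2 := by gcongr
    _ = ε := by field_simp; norm_num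

variable {A : H →L[ℂ] L} {σ : ℝ} {y₀ : L} {v : ℝ → H} {G : ℝ → StrongDual ℝ H}

lemma IsWeakSolution.exists_good_set (h : IsWeakSolution A σ y₀ v G) (hσ : σ * σ = 1) :
    ∃ K : ℝ, 0 ≤ K ∧ ∃ E : Set ℝ, E ⊆ Ioi 0 ∧ (∀ᵐ t, t ∈ Ioi (0 : ℝ) → t ∈ E) ∧
      (∀ t ∈ E, ‖v t‖ ≤ K) ∧ ∀ s ∈ E, ∀ t ∈ E,
        dualEmb A (Complex.I • A (v t - v s)) = - σ • (prim G t - prim G s) := by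
  set K := (eLpNorm v ∞ (volume.restrict (Ioi (0 : ℝ)))).toReal with hK
  have hb : ∀ᵐ t ∂(volume.restrict (Ioi (0 : ℝ))), ‖v t‖ ≤ K := by
    have h1 := h.bounded.2.ne
    filter_upwards [ae_le_eLpNormEssSup (f := v) (μ := volume.restrict (Ioi 0))] with t ht
    rw [hK, ← toReal_enorm]
    exact ENNReal.toReal_mono h1 (by simpa [eLpNorm_exponent_top] using ht)
  rw [ae_restrict_iff' measurableSet_Ioi] at hb
  refine ⟨K, ENNReal.toReal_nonneg, {t | t ∈ Ioi (0 : ℝ) ∧ ‖v t‖ ≤ K ∧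
    σ • dualEmb A (Complex.I • A (v t)) = σ • dualEmb A (Complex.I • y₀) - prim G t},
    fun t ht => ht.1, ?_, fun t ht => ht.2.1, fun s hs t ht => ?_⟩
  · filter_upwards [hb, h.ae_integrated] with t h1 h2 h3 using ⟨h3, h1 h3, h2 h3⟩
  · have e : σ • dualEmb A (Complex.I • A (v t - v s)) = - (prim G t - prim G s) := by
      rw [map_sub, smul_sub, dualEmb_sub, smul_sub, ht.2.2, hs.2.2]
      abel
    calc dualEmb A (Complex.I • A (v t - v s))
        = σ • σ • dualEmb A (Complex.I • A (v t - v s)) := by rw [smul_smul, hσ, one_smul]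
      _ = _ := by rw [e, smul_neg]; exact (neg_smul _ _).symm

lemma IsWeakSolution.exists_continuousOn [CompleteSpace L] (h : IsWeakSolution A σ y₀ v G)
    (hσ : σ * σ = 1) : ∃ U : ℝ → L, ContinuousOn U (Ici 0) ∧
      U =ᵐ[volume.restrict (Ioi 0)] fun t => A (v t) := by
  obtain ⟨K, hK0, E, hE, hEae, hEK, hEd⟩ := h.exists_good_set hσ
  have hcl : Ici (0 : ℝ) ⊆ closure E := by
    rw [← closure_Ioi]
    exact (closure_subset_closure_inter_of_ae isOpen_Ioi hEae).trans
      (closure_mono inter_subset_left)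
  have hσ1 : |σ| = 1 := by
    rcases mul_self_eq_one_iff.1 hσ with h | h <;> simp [h]
  have hest : ∀ s ∈ E, ∀ t ∈ E,
      ‖A (v t) - A (v s)‖ ^ 2 ≤ ‖prim G t - prim G s‖ * (2 * K) := by
    intro s hs t ht
    have e1 : ‖A (v t) - A (v s)‖ ^ 2 =
        dualEmb A (Complex.I • A (v t - v s)) (Complex.I • (v t - v s)) := by
      rw [dualEmb_apply, map_smul, inner_smul_left, inner_smul_right, ← map_sub,
        inner_self_eq_norm_sq_to_K, ← mul_assoc, Complex.conj_I, neg_mul, Complex.I_mul_I, neg_neg,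
        one_mul]
      norm_cast
    have e2 : ‖v t - v s‖ ≤ 2 * K := by
      linarith [norm_sub_le (v t) (v s), hEK s hs, hEK t ht]
    rw [e1, hEd s hs t ht]
    refine (le_abs_self _).trans ?_
    rw [← Real.norm_eq_abs]
    refine (ContinuousLinearMap.le_opNorm _ _).trans ?_
    rw [norm_smul, norm_neg, Real.norm_eq_abs, hσ1, one_mul, norm_smul, Complex.norm_I, one_mul]
    gcongr
  have hlim : ∀ x ∈ Ici (0 : ℝ), ∃ y, Tendsto (fun t => A (v t)) (𝓝[E] x) (𝓝 y) := by
    intro x hx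
    have hne : (𝓝[E] x).NeBot := mem_closure_iff_nhdsWithin_neBot.1 (hcl hx)
    rw [← cauchy_map_iff_exists_tendsto, Metric.cauchy_iff]
    refine ⟨inferInstance, fun ε hε => ?_⟩
    have hT : (0 : ℝ) < x + 1 := by linarith [mem_Ici.1 hx]
    obtain ⟨C, hC0, hC⟩ := exists_norm_prim_sub_le h.force hT
    set δ := min 1 (ε ^ 2 / (4 * C * K + 1)) with hδ
    have hδ0 : 0 < δ := lt_min one_pos (by positivity)
    refine ⟨(fun t => A (v t)) '' (E ∩ Metric.ball x δ), image_mem_map ?_, ?_⟩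
    · exact inter_mem self_mem_nhdsWithin (mem_nhdsWithin_of_mem_nhds (Metric.ball_mem_nhds x hδ0))
    · rintro _ ⟨s, ⟨hs, hsx⟩, rfl⟩ _ ⟨t, ⟨ht, htx⟩, rfl⟩
      rw [Metric.mem_ball, Real.dist_eq, abs_lt] at hsx htx
      have h1 : δ ≤ 1 := min_le_left _ _
      have h2 : δ ≤ ε ^ 2 / (4 * C * K + 1) := min_le_right _ _
      have h3 := hC t ⟨(hE ht).le, by linarith⟩ s ⟨(hE hs).le, by linarith⟩
      have h4 : |s - t| ≤ 2 * δ := by rw [abs_le]; constructor <;> linarith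
      rw [dist_eq_norm]
      refine lt_of_pow_lt_pow_left₀ 2 hε.le ?_
      calc _ ≤ ‖prim G s - prim G t‖ * (2 * K) := hest t ht s hs
        _ ≤ (C * (2 * δ)) * (2 * K) := by gcongr; exact h3.trans (by gcongr)
        _ = (4 * C * K) * δ := by ring
        _ < (4 * C * K + 1) * δ := by linarith
        _ ≤ (4 * C * K + 1) * (ε ^ 2 / (4 * C * K + 1)) := by gcongr
        _ = ε ^ 2 := by field_simp
  refine ⟨extendFrom E fun t => A (v t), continuousOn_extendFrom hcl hlim, ?_⟩
  rw [EventuallyEq, ae_restrict_iff' measurableSet_Ioi]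
  filter_upwards [hEae] with t ht h0
  have h1 : t ∈ Ici (0 : ℝ) := (mem_Ioi.1 h0).le
  obtain ⟨y, hy⟩ := hlim t h1
  have : y = A (v t) := tendsto_nhds_unique
    (hy.mono_left (pure_le_nhdsWithin (ht h0))) (tendsto_pure_nhds _ _)
  exact extendFrom_eq (hcl h1) (this ▸ hy)

/-- The growth of a quadratic form `⟨S U, U⟩` that commutes with the embedding is controlled by
the power `G(t)(i S v(t))`. -/
lemma IsWeakSolution.abs_quadratic_sub_le [CompleteSpace H] [CompleteSpace L]
    (h : IsWeakSolution A σ y₀ v G) (hσ : σ * σ = 1) (hA : Function.Injective A)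
    (S : H →L[ℂ] H) (R : L →L[ℂ] L) (hS : ∀ x, A (S x) = R (A x))
    (hR : ∀ x y, inner ℂ (R x) y = inner ℂ x (R y)) {B : ℝ}
    (hB : ∀ᵐ t ∂(volume.restrict (Ioi (0 : ℝ))), |G t (Complex.I • S (v t))| ≤ B)
    {U : ℝ → L} (hU : ContinuousOn U (Ici 0))
    (hUv : U =ᵐ[volume.restrict (Ioi 0)] fun t => A (v t)) {T : ℝ} (hT : 0 < T) :
    |(inner ℂ (R (U T)) (U T)).re - (inner ℂ (R (U 0)) (U 0)).re| ≤ 2 * B * T := by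
  obtain ⟨K, hK0, E₁, hE₁, hE₁ae, hE₁K, hE₁d⟩ := h.exists_good_set hσ
  have hσ1 : |σ| = 1 := by
    rcases mul_self_eq_one_iff.1 hσ with h | h <;> simp [h]
  rw [EventuallyEq, ae_restrict_iff' measurableSet_Ioi] at hUv
  rw [ae_restrict_iff' measurableSet_Ioi] at hB
  set E : Set ℝ := E₁ ∩ {t | U t = A (v t)} with hEdef
  have hE : E ⊆ Ioi 0 := fun t ht => hE₁ ht.1
  have hEae : ∀ᵐ t, t ∈ Ioi (0 : ℝ) → t ∈ E := by
    filter_upwards [hE₁ae, hUv] with t h1 h2 h3 using ⟨h1 h3, h2 h3⟩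
  set m : ℝ → ℝ := fun t => (inner ℂ (R (U t)) (U t)).re with hm
  have hmc : ContinuousOn m (Ici 0) :=
    Complex.continuous_re.comp_continuousOn (fun t ht =>
      Filter.Tendsto.inner ((R.continuous.tendsto _).comp (hU t ht)) (hU t ht))
  have hdiff : ∀ s ∈ E, ∀ t ∈ E, m t - m s =
      - σ * (prim G t - prim G s) (Complex.I • S (v t + v s)) := by
    intro s hs t ht
    have e1 : - σ * (prim G t - prim G s) (Complex.I • S (v t + v s)) =
        (- σ • (prim G t - prim G s)) (Complex.I • S (v t + v s)) := rfl
    rw [e1, ← hE₁d s hs.1 t ht.1, dualEmb_apply, map_smul, hS, inner_smul_left, inner_smul_right,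
      ← mul_assoc, Complex.conj_I, neg_mul, Complex.I_mul_I, neg_neg, one_mul, map_sub, map_add,
      ← show U t = A (v t) from ht.2, ← show U s = A (v s) from hs.2, map_add, inner_add_right,
      inner_sub_left, inner_sub_left]
    have e2 : (inner ℂ (U t) (R (U s))).re = (inner ℂ (U s) (R (U t))).re := by
      rw [← hR, ← inner_conj_symm, Complex.conj_re]
    simp only [hm, hR, Complex.add_re, Complex.sub_re]
    linarith
  have hbd : ∀ s ∈ E, ∀ t ∈ E, ‖Complex.I • S (v t + v s)‖ ≤ ‖S‖ * (2 * K) := by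
    intro s hs t ht
    rw [norm_smul, Complex.norm_I, one_mul]
    refine (S.le_opNorm _).trans ?_
    gcongr
    linarith [norm_add_le (v t) (v s), hE₁K s hs.1, hE₁K t ht.1]
  obtain ⟨C, hC0, hC⟩ := exists_norm_prim_sub_le h.force hT
  have hlip : LipschitzOnWith (Real.toNNReal (C * (‖S‖ * (2 * K)))) m (Icc 0 T) := by
    have h1 : LipschitzOnWith (Real.toNNReal (C * (‖S‖ * (2 * K)))) m (E ∩ Ioo 0 T) := by
      refine LipschitzOnWith.of_dist_le_mul fun t ht s hs => ?_
      rw [Real.dist_eq, Real.dist_eq, hdiff s hs.1 t ht.1, abs_mul, abs_neg, hσ1, one_mul,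
        Real.coe_toNNReal _ (by positivity), ← Real.norm_eq_abs]
      refine (ContinuousLinearMap.le_opNorm _ _).trans ?_
      calc _ ≤ (C * |t - s|) * (‖S‖ * (2 * K)) := by
            gcongr
            · exact hC s ⟨hs.2.1.le, hs.2.2.le⟩ t ⟨ht.2.1.le, ht.2.2.le⟩
            · exact hbd s hs.1 t ht.1
        _ = _ := by ring
    have h2 : Icc 0 T = closure (E ∩ Ioo 0 T) := by
      refine Subset.antisymm ?_ (closure_minimal (fun t ht => Ioo_subset_Icc_self ht.2)
        isClosed_Icc)
      rw [← closure_Ioo hT.ne]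
      refine closure_subset_closure_inter_of_ae isOpen_Ioo ?_
      filter_upwards [hEae] with t h1 h2 using h1 h2.1
    have h3 : ContinuousOn m (closure (E ∩ Ioo 0 T)) := by
      rw [← h2]
      exact hmc.mono fun t ht => ht.1
    rw [h2]
    exact h1.closure h3
  have hac : AbsolutelyContinuousOnInterval m 0 T := by
    apply LipschitzOnWith.absolutelyContinuousOnInterval
    rw [uIcc_of_le hT.le]
    exact hlip
  have hder : ∀ᵐ t, t ∈ Ioo 0 T → ‖deriv m t‖ ≤ 2 * B := by
    filter_upwards [hac.ae_differentiableAt, hEae, hB, _root_.LocallyIntegrable.ae_hasDerivAt_integral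
      (locallyIntegrable_indicator_of_memLp h.force)] with t h1 h2 h3 h4 ht
    have hd := (h1 (by rw [uIcc_of_le hT.le]; exact ⟨ht.1.le, ht.2.le⟩)).hasDerivAt
    have htE := h2 ht.1
    have hp : HasDerivAt (prim G) (G t) t := by
      have := h4 0
      rwa [indicator_of_mem (show t ∈ Ioi 0 from ht.1)] at this
    rw [hasDerivAt_iff_tendsto_slope] at hd hp
    have hne : (𝓝[E \ {t}] t).NeBot := by
      rw [← mem_closure_iff_nhdsWithin_neBot]
      have hae : ∀ᵐ s, s ∈ Ioi (0 : ℝ) → s ∈ E \ {t} := by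
        have : ∀ᵐ s : ℝ, s ≠ t := by simp [ae_iff]
        filter_upwards [hEae, this] with s h5 h6 h7 using ⟨h5 h7, h6⟩
      exact closure_mono inter_subset_left
        (closure_subset_closure_inter_of_ae isOpen_Ioi hae (subset_closure ht.1))
    have hle : 𝓝[E \ {t}] t ≤ 𝓝[≠] t := nhdsWithin_mono _ fun s hs => hs.2
    have hAv : Tendsto (fun s => A (v s)) (𝓝[E \ {t}] t) (𝓝 (A (v t))) := by
      have h5 : Tendsto U (𝓝[E \ {t}] t) (𝓝 (U t)) :=
        (hU t ht.1.le).mono_left (nhdsWithin_mono _ fun s hs => mem_Ici.2 (mem_Ioi.1 (hE hs.1)).le)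
      rw [show U t = A (v t) from htE.2] at h5
      refine h5.congr' ?_
      filter_upwards [self_mem_nhdsWithin] with s hs using hs.1.2
    have hweak : Tendsto (fun s => G t (Complex.I • S (v s + v t))) (𝓝[E \ {t}] t)
        (𝓝 (G t (Complex.I • S (v t + v t)))) := by
      let Q : H →L[ℝ] H := (Complex.I • S).restrictScalars ℝ
      have h6 := tendsto_dual_apply_of_injective hA (w := fun s => v s) (w₀ := v t) (K := K)
        (by filter_upwards [self_mem_nhdsWithin] with s hs using hE₁K s hs.1.1) hAv ((G t).comp Q)
      have h7 := h6.add_const (((G t).comp Q) (v t))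
      simp_rw [← map_add] at h7
      exact h7
    have hstrong : Tendsto (fun s => (slope (prim G) t s - G t) (Complex.I • S (v s + v t)))
        (𝓝[E \ {t}] t) (𝓝 0) := by
      have h8 := (tendsto_iff_norm_sub_tendsto_zero.1 (hp.mono_left hle)).mul_const (‖S‖ * (2 * K))
      rw [zero_mul] at h8
      refine squeeze_zero_norm' ?_ h8
      filter_upwards [self_mem_nhdsWithin] with s hs
      refine (ContinuousLinearMap.le_opNorm _ _).trans ?_
      gcongr
      exact hbd t htE s hs.1
    have hlim : Tendsto (slope m t) (𝓝[E \ {t}] t)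
        (𝓝 (- σ * (0 + G t (Complex.I • S (v t + v t))))) := by
      refine ((hstrong.add hweak).const_mul (- σ)).congr' ?_
      filter_upwards [self_mem_nhdsWithin] with s hs
      rw [slope_def_field, slope_def_module, hdiff t htE s hs.1]
      simp only [sub_apply, smul_apply, smul_eq_mul]
      ring
    rw [tendsto_nhds_unique (hd.mono_left hle) hlim, zero_add, norm_mul, norm_neg,
      Real.norm_eq_abs, hσ1, one_mul, Real.norm_eq_abs, map_add, smul_add, map_add]
    have := h3 ht.1
    linarith [abs_add_le (G t (Complex.I • S (v t))) (G t (Complex.I • S (v t)))]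
  rw [← hac.integral_deriv_eq_sub, ← Real.norm_eq_abs]
  have hfin := intervalIntegral.norm_integral_le_of_norm_le_const_ae (f := deriv m) (a := 0)
    (b := T) (C := 2 * B) (by
      have hT' : ∀ᵐ t : ℝ, t ≠ T := by simp [ae_iff]
      filter_upwards [hder, hT'] with t h1 h2 h3
      rw [uIoc_of_le hT.le] at h3
      exact h1 ⟨h3.1, lt_of_le_of_ne h3.2 h2⟩)
  rwa [sub_zero, abs_of_pos hT] at hfin

end Evolution

section Sobolev

variable {N : ℕ} {Ω : Set (Space N)}

noncomputable instance : CompleteSpace (H10 Ω) :=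
  (Submodule.isClosed_topologicalClosure _).completeSpace_coe

/-- The embedding of `H¹₀(Ω)` into `L²(Ω)`. -/
noncomputable def toL2L (Ω : Set (Space N)) : H10 Ω →L[ℂ] L2 Ω :=
  (WithLp.fstL 2 ℂ (L2 Ω) (L2vec Ω)).comp (H10 Ω).subtypeL

/-- The gradient as an operator on `H¹₀(Ω)`. -/
noncomputable def gradL (Ω : Set (Space N)) : H10 Ω →L[ℂ] L2vec Ω :=
  (WithLp.sndL 2 ℂ (L2 Ω) (L2vec Ω)).comp (H10 Ω).subtypeL

@[simp] lemma toL2L_apply (v : H10 Ω) : toL2L Ω v = toL2 v := rfl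

@[simp] lemma gradL_apply (v : H10 Ω) : gradL Ω v = grad v := rfl

lemma ext_toL2_grad {v w : H10 Ω} (h1 : toL2 v = toL2 w) (h2 : grad v = grad w) : v = w :=
  Subtype.ext ((WithLp.ofLp_injective 2) (Prod.ext h1 h2))

lemma pderiv_smooth {F : Type*} [NormedAddCommGroup F] [NormedSpace ℝ F] {φ : Space N → F}
    (hφ : ContDiff ℝ ∞ φ) (j : Fin N) : ContDiff ℝ ∞ (pderiv j φ) :=
  (hφ.fderiv_right (m := ∞) (by simp)).clm_apply contDiff_const

lemma support_pderiv_subset {F : Type*} [NormedAddCommGroup F] [NormedSpace ℝ F] (φ : Space N → F)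
    (j : Fin N) : Function.support (pderiv j φ) ⊆ tsupport φ := by
  intro x hx
  by_contra h
  refine hx ?_
  have : x ∉ tsupport (fderiv ℝ φ) := fun h' => h (tsupport_fderiv_subset ℝ h')
  simp [pderiv, image_eq_zero_of_notMem_tsupport this]

lemma hasCompactSupport_pderiv {F : Type*} [NormedAddCommGroup F] [NormedSpace ℝ F]
    {φ : Space N → F} (hφ : HasCompactSupport φ) (j : Fin N) : HasCompactSupport (pderiv j φ) :=
  HasCompactSupport.intro hφ.isCompact fun x hx => by
    by_contra h
    exact hx (support_pderiv_subset φ j h)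

lemma continuous_cgrad {φ : Space N → ℂ} (hφ : ContDiff ℝ ∞ φ) : Continuous (cgrad φ) :=
  (PiLp.continuous_toLp 2 _).comp (continuous_pi fun j => (pderiv_smooth hφ j).continuous)

lemma IsTest.memLp_cgrad {φ : Space N → ℂ} (hφ : IsTest Ω φ) :
    MemLp (cgrad φ) 2 (volume.restrict Ω) := by
  refine (continuous_cgrad hφ.smooth).memLp_of_hasCompactSupport
    (HasCompactSupport.intro hφ.compact.isCompact fun x hx => ?_)
  ext j
  by_contra h
  exact hx (support_pderiv_subset φ j h)

lemma IsTest.memLp {φ : Space N → ℂ} (hφ : IsTest Ω φ) : MemLp φ 2 (volume.restrict Ω) :=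
  hφ.smooth.continuous.memLp_of_hasCompactSupport hφ.compact

/-- A test function as an element of `H¹₀(Ω)`. -/
lemma IsTest.exists_H10 {φ : Space N → ℂ} (hφ : IsTest Ω φ) :
    ∃ v : H10 Ω, (toL2 v : Space N → ℂ) =ᵐ[volume.restrict Ω] φ ∧
      (grad v : Space N → EuclideanSpace ℂ (Fin N)) =ᵐ[volume.restrict Ω] cgrad φ := by
  let p : WithLp 2 (L2 Ω × L2vec Ω) := WithLp.toLp 2 (hφ.memLp.toLp φ, hφ.memLp_cgrad.toLp _)
  have h1 : (p.fst : Space N → ℂ) =ᵐ[volume.restrict Ω] φ := hφ.memLp.coeFn_toLp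
  have h2 : (p.snd : Space N → EuclideanSpace ℂ (Fin N)) =ᵐ[volume.restrict Ω] cgrad φ :=
    hφ.memLp_cgrad.coeFn_toLp
  exact ⟨⟨p, Submodule.le_topologicalClosure _ (Submodule.subset_span ⟨φ, hφ, h1, h2⟩)⟩, h1, h2⟩

lemma H10_le {K : Submodule ℂ (WithLp 2 (L2 Ω × L2vec Ω))}
    (hK : IsClosed (K : Set (WithLp 2 (L2 Ω × L2vec Ω))))
    (h : ∀ (p : WithLp 2 (L2 Ω × L2vec Ω)) (φ : Space N → ℂ), IsTest Ω φ →
      (p.fst : Space N → ℂ) =ᵐ[volume.restrict Ω] φ →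
      (p.snd : Space N → EuclideanSpace ℂ (Fin N)) =ᵐ[volume.restrict Ω] cgrad φ → p ∈ K) :
    H10 Ω ≤ K := by
  refine Submodule.topologicalClosure_minimal _ (Submodule.span_le.2 ?_) hK
  rintro p ⟨φ, h1, h2, h3⟩
  exact h p φ h1 h2 h3

section Multiplier

/-- Smooth bounded functions with bounded gradient. -/
structure IsMultiplier (a : Space N → ℝ) : Prop where
  smooth : ContDiff ℝ ∞ a
  bounded : ∃ C : ℝ, ∀ x, |a x| ≤ C
  fderiv_bounded : ∃ C : ℝ, ∀ x, ‖fderiv ℝ a x‖ ≤ C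

variable {a : Space N → ℝ}

lemma contDiff_ofReal_comp (ha : ContDiff ℝ ∞ a) : ContDiff ℝ ∞ fun x => (a x : ℂ) :=
  Complex.ofRealCLM.contDiff.comp ha

lemma pderiv_ofReal_comp (ha : ContDiff ℝ ∞ a) (j : Fin N) (x : Space N) :
    pderiv j (fun x => (a x : ℂ)) x = ((pderiv j a x : ℝ) : ℂ) := by
  have h1 : HasFDerivAt a (fderiv ℝ a x) x :=
    ((ha.differentiable (by simp)) x).hasFDerivAt
  have h2 := (Complex.ofRealCLM.hasFDerivAt (x := a x)).comp x h1
  have h3 : fderiv ℝ (fun x => (a x : ℂ)) x = Complex.ofRealCLM.comp (fderiv ℝ a x) := h2.fderiv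
  rw [pderiv, h3]
  rfl

lemma gradient_apply_eq_pderiv (j : Fin N) (x : Space N) : gradient a x j = pderiv j a x := by
  have : inner ℝ (gradient a x) (EuclideanSpace.single j (1 : ℝ)) = pderiv j a x := by
    rw [gradient, InnerProductSpace.toDual_symm_apply]
    rfl
  rw [← this, EuclideanSpace.inner_single_right]
  simp

lemma norm_cgrad_ofReal (ha : ContDiff ℝ ∞ a) (x : Space N) :
    ‖cgrad (fun x => (a x : ℂ)) x‖ = ‖fderiv ℝ a x‖ := by
  have h1 : ‖fderiv ℝ a x‖ = ‖gradient a x‖ := by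
    rw [gradient, LinearIsometryEquiv.norm_map]
  rw [h1, EuclideanSpace.norm_eq, EuclideanSpace.norm_eq]
  congr 1
  refine Finset.sum_congr rfl fun j _ => ?_
  rw [gradient_apply_eq_pderiv, cgrad, PiLp.toLp_apply, pderiv_ofReal_comp ha, Complex.norm_real]

lemma IsMultiplier.memLp_ofReal (ha : IsMultiplier a) :
    MemLp (fun x => (a x : ℂ)) ∞ (volume.restrict Ω) := by
  obtain ⟨C, hC⟩ := ha.bounded
  exact memLp_top_of_bound (contDiff_ofReal_comp ha.smooth).continuous.aestronglyMeasurable C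
    (Eventually.of_forall fun x => by rw [Complex.norm_real]; exact hC x)

lemma IsMultiplier.memLp_cgrad (ha : IsMultiplier a) :
    MemLp (cgrad fun x => (a x : ℂ)) ∞ (volume.restrict Ω) := by
  obtain ⟨C, hC⟩ := ha.fderiv_bounded
  exact memLp_top_of_bound
    (continuous_cgrad (contDiff_ofReal_comp ha.smooth)).aestronglyMeasurable C
    (Eventually.of_forall fun x => by rw [norm_cgrad_ofReal ha.smooth]; exact hC x)

lemma IsMultiplier.memW1inf (ha : IsMultiplier a) (Ω : Set (Space N)) : MemW1inf Ω a := by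
  have hdiff : Differentiable ℝ a := ha.smooth.differentiable (by simp)
  refine ⟨?_, gradient a, ?_, fun φ hφ j => ?_⟩
  · obtain ⟨C, hC⟩ := ha.bounded
    exact memLp_top_of_bound ha.smooth.continuous.aestronglyMeasurable C (Eventually.of_forall hC)
  · obtain ⟨C, hC⟩ := ha.fderiv_bounded
    have hcont : Continuous (gradient a) :=
      (LinearIsometryEquiv.continuous _).comp (ha.smooth.continuous_fderiv (by simp))
    refine memLp_top_of_bound hcont.aestronglyMeasurable C (Eventually.of_forall fun x => ?_)
    rw [gradient, LinearIsometryEquiv.norm_map]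
    exact hC x
  · have hφd : Differentiable ℝ φ := hφ.smooth.differentiable (by simp)
    have hφ0 : ∀ x, x ∉ Ω → φ x = 0 := fun x hx =>
      image_eq_zero_of_notMem_tsupport fun h => hx (hφ.support h)
    have hpφ0 : ∀ x, x ∉ Ω → pderiv j φ x = 0 := fun x hx => by
      by_contra h
      exact hx (hφ.support (support_pderiv_subset φ j h))
    rw [setIntegral_eq_integral_of_forall_compl_eq_zero fun x hx => by rw [hpφ0 x hx, mul_zero],
      setIntegral_eq_integral_of_forall_compl_eq_zero fun x hx => by rw [hφ0 x hx, mul_zero]]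
    simp_rw [gradient_apply_eq_pderiv]
    refine integral_mul_fderiv_eq_neg_fderiv_mul_of_integrable ?_ ?_ ?_ (fun x _ => hdiff x)
      (fun x _ => hφd x)
    · exact ((pderiv_smooth ha.smooth j).continuous.mul
        hφ.smooth.continuous).integrable_of_hasCompactSupport hφ.compact.mul_left
    · exact (ha.smooth.continuous.mul
        (pderiv_smooth hφ.smooth j).continuous).integrable_of_hasCompactSupport
        (hasCompactSupport_pderiv hφ.compact j).mul_left
    · exact (ha.smooth.continuous.mul
        hφ.smooth.continuous).integrable_of_hasCompactSupport hφ.compact.mul_left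

lemma cgrad_mul {φ : Space N → ℂ} (ha : ContDiff ℝ ∞ a) (hφ : ContDiff ℝ ∞ φ) (x : Space N) :
    cgrad (fun x => (a x : ℂ) * φ x) x =
      (a x : ℂ) • cgrad φ x + φ x • cgrad (fun x => (a x : ℂ)) x := by
  have h1 : DifferentiableAt ℝ (fun x => (a x : ℂ)) x :=
    (contDiff_ofReal_comp ha).differentiable (by simp) x
  have h2 : DifferentiableAt ℝ φ x := hφ.differentiable (by simp) x
  ext j
  simp only [cgrad, pderiv, PiLp.toLp_apply, PiLp.add_apply, PiLp.smul_apply, smul_eq_mul]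
  rw [fderiv_fun_mul h1 h2]
  simp

lemma IsTest.ofReal_mul {φ : Space N → ℂ} (hφ : IsTest Ω φ) (ha : ContDiff ℝ ∞ a) :
    IsTest Ω (fun x => (a x : ℂ) * φ x) :=
  ⟨(contDiff_ofReal_comp ha).mul hφ.smooth, hφ.compact.mul_left,
    (tsupport_mul_subset_right).trans hφ.support⟩

/-- Multiplication by `a` on `L²(Ω)`. -/
noncomputable def mulL2 (Ω : Set (Space N)) (ha : IsMultiplier a) : L2 Ω →L[ℂ] L2 Ω :=
  (ContinuousLinearMap.lsmul ℂ ℂ).holderL (volume.restrict Ω) ∞ 2 2 (ha.memLp_ofReal.toLp _)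

lemma coeFn_mulL2 (ha : IsMultiplier a) (u : L2 Ω) :
    (mulL2 Ω ha u : Space N → ℂ) =ᵐ[volume.restrict Ω] fun x => (a x : ℂ) * u x := by
  rw [mulL2, ContinuousLinearMap.holderL_apply_apply]
  filter_upwards [ContinuousLinearMap.coeFn_holder (r := 2) (ContinuousLinearMap.lsmul ℂ ℂ)
    (ha.memLp_ofReal.toLp _) u, ha.memLp_ofReal.coeFn_toLp (μ := volume.restrict Ω)] with x h1 h2
  rw [h1, h2]
  rfl

lemma inner_mulL2 (ha : IsMultiplier a) (u w : L2 Ω) :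
    inner ℂ (mulL2 Ω ha u) w = inner ℂ u (mulL2 Ω ha w) := by
  rw [L2.inner_def, L2.inner_def]
  apply integral_congr_ae
  filter_upwards [coeFn_mulL2 ha u, coeFn_mulL2 ha w] with x h1 h2
  rw [h1, h2]
  simp only [RCLike.inner_apply, map_mul, Complex.conj_ofReal]
  ring

/-- Multiplication by `a` on `L²(Ω; ℂ^N)`. -/
noncomputable def mulL2vec (Ω : Set (Space N)) (ha : IsMultiplier a) : L2vec Ω →L[ℂ] L2vec Ω :=
  (ContinuousLinearMap.lsmul ℂ ℂ).holderL (volume.restrict Ω) ∞ 2 2 (ha.memLp_ofReal.toLp _)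

lemma coeFn_mulL2vec (ha : IsMultiplier a) (u : L2vec Ω) :
    (mulL2vec Ω ha u : Space N → EuclideanSpace ℂ (Fin N)) =ᵐ[volume.restrict Ω]
      fun x => (a x : ℂ) • u x := by
  rw [mulL2vec, ContinuousLinearMap.holderL_apply_apply]
  filter_upwards [ContinuousLinearMap.coeFn_holder (r := 2) (ContinuousLinearMap.lsmul ℂ ℂ)
    (ha.memLp_ofReal.toLp _) u, ha.memLp_ofReal.coeFn_toLp (μ := volume.restrict Ω)] with x h1 h2
  rw [h1, h2]
  rfl

/-- The operator `u ↦ u ∇a` from `L²(Ω)` to `L²(Ω; ℂ^N)`. -/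
noncomputable def mulGrad (Ω : Set (Space N)) (ha : IsMultiplier a) : L2 Ω →L[ℂ] L2vec Ω :=
  (ContinuousLinearMap.lsmul ℂ ℂ : ℂ →L[ℂ] EuclideanSpace ℂ (Fin N) →L[ℂ] _).flip.holderL
    (volume.restrict Ω) ∞ 2 2 (ha.memLp_cgrad.toLp _)

lemma coeFn_mulGrad (ha : IsMultiplier a) (u : L2 Ω) :
    (mulGrad Ω ha u : Space N → EuclideanSpace ℂ (Fin N)) =ᵐ[volume.restrict Ω]
      fun x => u x • cgrad (fun x => (a x : ℂ)) x := by
  rw [mulGrad, ContinuousLinearMap.holderL_apply_apply]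
  filter_upwards [ContinuousLinearMap.coeFn_holder (r := 2)
    (ContinuousLinearMap.lsmul ℂ ℂ : ℂ →L[ℂ] EuclideanSpace ℂ (Fin N) →L[ℂ] _).flip
    (ha.memLp_cgrad.toLp _) u, ha.memLp_cgrad.coeFn_toLp (μ := volume.restrict Ω)] with x h1 h2
  rw [h1, h2]
  rfl

lemma norm_mulGrad_le (ha : IsMultiplier a) {C : ℝ} (hC : ∀ x, ‖fderiv ℝ a x‖ ≤ C) (u : L2 Ω) :
    ‖mulGrad Ω ha u‖ ≤ C * ‖u‖ := by
  apply Lp.norm_le_mul_norm_of_ae_le_mul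
  filter_upwards [coeFn_mulGrad ha u] with x hx
  rw [hx, norm_smul, norm_cgrad_ofReal ha.smooth, mul_comm]
  gcongr
  exact hC x

lemma inner_mulL2vec_self_im (ha : IsMultiplier a) (u : L2vec Ω) :
    (inner ℂ (mulL2vec Ω ha u) u).im = 0 := by
  have h : inner ℂ (mulL2vec Ω ha u) u = inner ℂ u (mulL2vec Ω ha u) := by
    rw [L2.inner_def, L2.inner_def]
    apply integral_congr_ae
    filter_upwards [coeFn_mulL2vec ha u] with x h1
    rw [h1, inner_smul_left, inner_smul_right, Complex.conj_ofReal]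
  rw [← inner_conj_symm] at h
  have := congrArg Complex.im h
  rw [Complex.conj_im] at this
  rw [← inner_conj_symm, Complex.conj_im]
  linarith

/-- Multiplication by `a` on pairs `(u, ∇u)`. -/
noncomputable def mulPair (Ω : Set (Space N)) (ha : IsMultiplier a) :
    WithLp 2 (L2 Ω × L2vec Ω) →L[ℂ] WithLp 2 (L2 Ω × L2vec Ω) :=
  ((WithLp.prodContinuousLinearEquiv 2 ℂ (L2 Ω) (L2vec Ω)).symm :
      (L2 Ω × L2vec Ω) →L[ℂ] WithLp 2 (L2 Ω × L2vec Ω)).comp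
    (((mulL2 Ω ha).comp (WithLp.fstL 2 ℂ _ _)).prod
      ((mulL2vec Ω ha).comp (WithLp.sndL 2 ℂ _ _) + (mulGrad Ω ha).comp (WithLp.fstL 2 ℂ _ _)))

lemma mulPair_mem (ha : IsMultiplier a) : ∀ p ∈ H10 Ω, mulPair Ω ha p ∈ H10 Ω := by
  change H10 Ω ≤ (H10 Ω).comap (mulPair Ω ha : WithLp 2 (L2 Ω × L2vec Ω) →ₗ[ℂ] _)
  refine H10_le ?_ fun p φ hφ h1 h2 => ?_
  · exact (Submodule.isClosed_topologicalClosure _).preimage (mulPair Ω ha).continuous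
  · refine Submodule.le_topologicalClosure _ (Submodule.subset_span
      ⟨_, hφ.ofReal_mul ha.smooth, ?_, ?_⟩)
    · change (mulL2 Ω ha p.fst : Space N → ℂ) =ᵐ[volume.restrict Ω] _
      filter_upwards [coeFn_mulL2 ha p.fst, h1] with x h3 h4
      rw [h3, h4]
    · change ((mulL2vec Ω ha p.snd + mulGrad Ω ha p.fst : L2vec Ω) :
        Space N → EuclideanSpace ℂ (Fin N)) =ᵐ[volume.restrict Ω] _
      filter_upwards [Lp.coeFn_add (mulL2vec Ω ha p.snd) (mulGrad Ω ha p.fst),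
        coeFn_mulL2vec ha p.snd, coeFn_mulGrad ha p.fst, h1, h2] with x h3 h4 h5 h6 h7
      rw [h3, Pi.add_apply, h4, h5, h6, h7, cgrad_mul ha.smooth hφ.smooth]

/-- Multiplication by `a` on `H¹₀(Ω)`. -/
noncomputable def mulH10 (Ω : Set (Space N)) (ha : IsMultiplier a) : H10 Ω →L[ℂ] H10 Ω :=
  (mulPair Ω ha).restrict (mulPair_mem ha)

lemma grad_mulH10 (ha : IsMultiplier a) (v : H10 Ω) :
    grad (mulH10 Ω ha v) = mulL2vec Ω ha (grad v) + mulGrad Ω ha (toL2 v) := rfl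

end Multiplier

section Gradient

/-- The `j`-th component of a vector field. -/
noncomputable def compL2 (Ω : Set (Space N)) (j : Fin N) : L2vec Ω →L[ℂ] L2 Ω :=
  (EuclideanSpace.proj j : EuclideanSpace ℂ (Fin N) →L[ℂ] ℂ).compLpL 2 (volume.restrict Ω)

lemma coeFn_compL2 (j : Fin N) (g : L2vec Ω) :
    (compL2 Ω j g : Space N → ℂ) =ᵐ[volume.restrict Ω] fun x => g x j :=
  ContinuousLinearMap.coeFn_compLpL _ _

lemma integral_conj_mul_pderiv {φ ψ : Space N → ℂ} (hφ : IsTest Ω φ) (hψ : IsTest Ω ψ)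
    (j : Fin N) :
    ∫ x in Ω, pderiv j ψ x * (starRingEnd ℂ) (φ x) =
      - ∫ x in Ω, ψ x * (starRingEnd ℂ) (pderiv j φ x) := by
  let φ' : Space N → ℂ := fun x => (starRingEnd ℂ) (φ x)
  have hφ' : ContDiff ℝ ∞ φ' := Complex.conjCLE.contDiff.comp hφ.smooth
  have hφc : HasCompactSupport φ' := hφ.compact.comp_left (g := starRingEnd ℂ) (by simp)
  have hder : ∀ x, fderiv ℝ φ' x (EuclideanSpace.single j 1) = (starRingEnd ℂ) (pderiv j φ x) := by
    intro x
    have h1 : HasFDerivAt φ (fderiv ℝ φ x) x :=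
      ((hφ.smooth.differentiable (by simp)) x).hasFDerivAt
    have h2 := (Complex.conjCLE.toContinuousLinearMap.hasFDerivAt (x := φ x)).comp x h1
    have h3 : fderiv ℝ φ' x = Complex.conjCLE.toContinuousLinearMap.comp (fderiv ℝ φ x) :=
      h2.fderiv
    rw [h3]
    rfl
  rw [setIntegral_eq_integral_of_forall_compl_eq_zero fun x hx => by
      rw [image_eq_zero_of_notMem_tsupport fun h => hx (hφ.support h), map_zero, mul_zero],
    setIntegral_eq_integral_of_forall_compl_eq_zero fun x hx => by
      rw [image_eq_zero_of_notMem_tsupport fun h => hx (hψ.support h), zero_mul]]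
  simp_rw [← hder]
  have := integral_mul_fderiv_eq_neg_fderiv_mul_of_integrable (μ := (volume : Measure (Space N)))
    (f := ψ) (g := φ') (v := EuclideanSpace.single j 1) ?_ ?_ ?_
    (fun x _ => hψ.smooth.differentiable (by simp) x) (fun x _ => hφ'.differentiable (by simp) x)
  · rw [this, neg_neg]
    rfl
  · exact ((pderiv_smooth hψ.smooth j).continuous.mul
      hφ'.continuous).integrable_of_hasCompactSupport hφc.mul_left
  · exact (hψ.smooth.continuous.mul
      (pderiv_smooth hφ' j).continuous).integrable_of_hasCompactSupport hψ.compact.mul_right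
  · exact (hψ.smooth.continuous.mul
      hφ'.continuous).integrable_of_hasCompactSupport hφc.mul_left

/-- Partial derivatives are skew-symmetric on `H¹₀(Ω)`. -/
lemma inner_compL2_grad (w v : H10 Ω) (j : Fin N) :
    inner ℂ (toL2 w) (compL2 Ω j (grad v)) + inner ℂ (compL2 Ω j (grad w)) (toL2 v) = 0 := by
  let b (w : WithLp 2 (L2 Ω × L2vec Ω)) : WithLp 2 (L2 Ω × L2vec Ω) →L[ℂ] ℂ :=
    (innerSL ℂ w.fst).comp ((compL2 Ω j).comp (WithLp.sndL 2 ℂ _ _)) +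
      (innerSL ℂ (compL2 Ω j w.snd)).comp (WithLp.fstL 2 ℂ _ _)
  have hb : ∀ p q, b p q =
      inner ℂ p.fst (compL2 Ω j q.snd) + inner ℂ (compL2 Ω j p.snd) q.fst := fun _ _ => rfl
  have hsymm : ∀ p q, b p q = (starRingEnd ℂ) (b q p) := by
    intro p q
    rw [hb, hb, map_add, inner_conj_symm, inner_conj_symm, add_comm]
  have hle : ∀ p, (∀ (q : WithLp 2 (L2 Ω × L2vec Ω)) (φ : Space N → ℂ), IsTest Ω φ →
      (q.fst : Space N → ℂ) =ᵐ[volume.restrict Ω] φ →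
      (q.snd : Space N → EuclideanSpace ℂ (Fin N)) =ᵐ[volume.restrict Ω] cgrad φ →
      b p q = 0) → ∀ q ∈ H10 Ω, b p q = 0 := by
    intro p h
    change H10 Ω ≤ (b p : WithLp 2 (L2 Ω × L2vec Ω) →ₗ[ℂ] ℂ).ker
    exact H10_le (b p).isClosed_ker h
  refine hle (w : WithLp 2 (L2 Ω × L2vec Ω)) (fun q ψ hψ h1 h2 => ?_) v v.2
  rw [hsymm, hle q (fun p φ hφ h3 h4 => ?_) w w.2, map_zero]
  rw [hb, L2.inner_def, L2.inner_def]
  have e1 : ∫ x in Ω, inner ℂ ((q.fst : Space N → ℂ) x) ((compL2 Ω j p.snd : Space N → ℂ) x) =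
      ∫ x in Ω, pderiv j φ x * (starRingEnd ℂ) (ψ x) := by
    apply integral_congr_ae
    filter_upwards [h1, h4, coeFn_compL2 j p.snd] with x h5 h6 h7
    rw [h5, h7, h6]
    rfl
  have e2 : ∫ x in Ω, inner ℂ ((compL2 Ω j q.snd : Space N → ℂ) x) ((p.fst : Space N → ℂ) x) =
      ∫ x in Ω, φ x * (starRingEnd ℂ) (pderiv j ψ x) := by
    apply integral_congr_ae
    filter_upwards [h2, h3, coeFn_compL2 j q.snd] with x h5 h6 h7
    rw [h6, h7, h5]
    rfl
  rw [e1, e2, integral_conj_mul_pderiv hψ hφ, neg_add_cancel]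

/-- An element of `H¹₀(Ω)` is determined by its class in `L²(Ω)`. -/
lemma toL2L_injective (hΩ : IsOpen Ω) : Function.Injective (toL2L Ω) := by
  rw [injective_iff_map_eq_zero]
  intro v hv
  rw [toL2L_apply] at hv
  have hcomp : ∀ j : Fin N, ∀ᵐ x ∂(volume.restrict Ω), (compL2 Ω j (grad v) : Space N → ℂ) x = 0 := by
    intro j
    rw [ae_restrict_iff' hΩ.measurableSet]
    refine hΩ.ae_eq_zero_of_integral_contDiff_smul_eq_zero ?_ fun g hg hgc hgt => ?_
    · refine locallyIntegrableOn_of_locallyIntegrable_restrict ?_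
      exact (Lp.memLp (compL2 Ω j (grad v))).locallyIntegrable (by norm_num)
    · have hgT : IsTest Ω fun x => (g x : ℂ) :=
        ⟨contDiff_ofReal_comp hg, hgc.comp_left (g := fun r : ℝ => (r : ℂ)) (by simp),
          (closure_mono fun x hx => by
            simpa using hx).trans hgt⟩
      obtain ⟨w, hw, -⟩ := hgT.exists_H10
      have h1 := inner_compL2_grad w v j
      rw [hv, inner_zero_right, add_zero, L2.inner_def] at h1
      rw [← setIntegral_eq_integral_of_forall_compl_eq_zero (s := Ω) fun x hx => by
        rw [image_eq_zero_of_notMem_tsupport fun h => hx (hgt h), zero_smul], ← h1]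
      apply integral_congr_ae
      filter_upwards [hw] with x hx
      rw [hx]
      simp [RCLike.inner_apply, mul_comm]
  have hg : grad v = 0 := by
    rw [Lp.eq_zero_iff_ae_eq_zero]
    have h2 : ∀ᵐ x ∂(volume.restrict Ω), ∀ j : Fin N, (compL2 Ω j (grad v) : Space N → ℂ) x = 0 :=
      ae_all_iff.2 hcomp
    have h3 : ∀ᵐ x ∂(volume.restrict Ω), ∀ j : Fin N,
        (compL2 Ω j (grad v) : Space N → ℂ) x = grad v x j := ae_all_iff.2 fun j => coeFn_compL2 j _
    filter_upwards [h2, h3] with x h4 h5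
    ext j
    rw [← h5 j, h4 j]
    rfl
  exact ext_toL2_grad hv hg

lemma isMultiplier_arctan (j : Fin N) : IsMultiplier fun x : Space N => Real.arctan (x j) := by
  have hproj : ContDiff ℝ ∞ fun x : Space N => x j :=
    (EuclideanSpace.proj j : Space N →L[ℝ] ℝ).contDiff
  refine ⟨Real.contDiff_arctan.comp hproj, ⟨Real.pi / 2, fun x => ?_⟩, ⟨1, fun x => ?_⟩⟩
  · rw [abs_le]
    exact ⟨(Real.neg_pi_div_two_lt_arctan _).le, (Real.arctan_lt_pi_div_two _).le⟩
  · have h1 := ((EuclideanSpace.proj j : Space N →L[ℝ] ℝ).hasFDerivAt (x := x)).arctan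
    rw [show fderiv ℝ (fun x : Space N => Real.arctan (x j)) x = _ from h1.fderiv]
    refine ContinuousLinearMap.opNorm_le_bound _ zero_le_one fun y => ?_
    rw [smul_apply, norm_smul, one_mul, Real.norm_eq_abs]
    have h2 : ‖(EuclideanSpace.proj j : Space N →L[ℝ] ℝ) y‖ ≤ ‖y‖ := PiLp.norm_apply_le y j
    have h3 : |1 / (1 + (EuclideanSpace.proj j : Space N →L[ℝ] ℝ) x ^ 2)| ≤ 1 := by
      rw [abs_of_pos (by positivity), div_le_one (by positivity)]
      nlinarith [sq_nonneg ((EuclideanSpace.proj j : Space N →L[ℝ] ℝ) x)]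
    exact (mul_le_of_le_one_left (norm_nonneg _) h3).trans h2

lemma pderiv_arctan (j : Fin N) (x : Space N) :
    pderiv j (fun x : Space N => Real.arctan (x j)) x = 1 / (1 + x j ^ 2) := by
  have h1 := ((EuclideanSpace.proj j : Space N →L[ℝ] ℝ).hasFDerivAt (x := x)).arctan
  rw [pderiv, show fderiv ℝ (fun x : Space N => Real.arctan (x j)) x = _ from h1.fderiv]
  simp

/-- A function in `H¹₀(Ω)` with vanishing gradient vanishes. -/
lemma toL2_eq_zero_of_grad_eq_zero (hN : 1 ≤ N) {v : H10 Ω} (hv : grad v = 0) : toL2 v = 0 := by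
  let j : Fin N := ⟨0, hN⟩
  have ha := isMultiplier_arctan j
  have h1 := inner_compL2_grad (mulH10 Ω ha v) v j
  rw [hv, map_zero, inner_zero_right, zero_add, grad_mulH10, hv, map_zero, zero_add,
    L2.inner_def] at h1
  have e : (fun x => inner ℂ ((compL2 Ω j (mulGrad Ω ha (toL2 v)) : Space N → ℂ) x) (toL2 v x))
      =ᵐ[volume.restrict Ω] fun x => ((1 / (1 + x j ^ 2) * ‖toL2 v x‖ ^ 2 : ℝ) : ℂ) := by
    filter_upwards [coeFn_compL2 j (mulGrad Ω ha (toL2 v)), coeFn_mulGrad ha (toL2 v)] with x h2 h3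
    rw [h2, h3, PiLp.smul_apply, cgrad, PiLp.toLp_apply, pderiv_ofReal_comp ha.smooth,
      pderiv_arctan, RCLike.inner_apply, smul_eq_mul, map_mul, Complex.conj_ofReal, ← mul_assoc,
      Complex.mul_conj, Complex.normSq_eq_norm_sq, mul_comm]
    push_cast
    rfl
  rw [integral_congr_ae e, integral_complex_ofReal] at h1
  have h1' : ∫ x in Ω, (1 / (1 + x j ^ 2) * ‖toL2 v x‖ ^ 2 : ℝ) = 0 := by exact_mod_cast h1
  have hsq : Integrable (fun x => ‖toL2 v x‖ ^ 2) (volume.restrict Ω) :=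
    (Lp.memLp (toL2 v)).integrable_norm_pow (by norm_num)
  have hint : Integrable (fun x : Space N => 1 / (1 + x j ^ 2) * ‖toL2 v x‖ ^ 2)
      (volume.restrict Ω) := by
    refine hsq.bdd_mul (c := 1) ?_ (Eventually.of_forall fun x => ?_)
    · have : Continuous fun x : Space N => 1 / (1 + x j ^ 2) := by
        have : Continuous fun x : Space N => x j :=
          (EuclideanSpace.proj j : Space N →L[ℝ] ℝ).continuous
        exact continuous_const.div (continuous_const.add (this.pow 2)) fun x => by positivity
      exact this.aestronglyMeasurable
    · rw [Real.norm_eq_abs, abs_of_pos (by positivity), div_le_one (by positivity)]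
      nlinarith [sq_nonneg (x j)]
  rw [integral_eq_zero_iff_of_nonneg (fun x => by positivity) hint] at h1'
  rw [Lp.eq_zero_iff_ae_eq_zero]
  filter_upwards [h1'] with x hx
  have hpos : (0 : ℝ) < 1 / (1 + x j ^ 2) := by positivity
  have : ‖toL2 v x‖ ^ 2 = 0 := by
    rcases mul_eq_zero.1 hx with h | h
    · exact absurd h hpos.ne'
    · exact h
  simpa using this

end Gradient

end Sobolev

section Cutoff

lemma exists_smooth_step {δ : ℝ} (hδ : 0 < δ) :
    ∃ h : ℝ → ℝ, ContDiff ℝ ∞ h ∧ (∀ s, 0 ≤ h s ∧ h s ≤ 1) ∧ (∀ s, 1 ≤ s → h s = 1) ∧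
      (∃ κ : ℝ, 0 < κ ∧ ∀ s ≤ κ, h s = 0) ∧ LipschitzWith (Real.toNNReal (1 + δ)) h := by
  set r : ℝ := 1 / (2 * (1 + δ)) with hr
  have hr0 : 0 < r := by positivity
  have hr1 : r < 1 / 2 := by
    rw [hr, div_lt_div_iff₀ (by positivity) (by norm_num)]
    linarith
  let b : ContDiffBump (1 / 2 : ℝ) := ⟨r, (r + 1 / 2) / 2, hr0, by linarith⟩
  let ρ : ℝ → ℝ := b.normed volume
  have hρs : ContDiff ℝ ∞ ρ := b.contDiff_normed
  have hρ0 : ∀ x, 0 ≤ ρ x := b.nonneg_normed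
  have hρ1 : ∫ t, ρ t = 1 := b.integral_normed
  have hρi : Integrable ρ := b.integrable_normed
  have hρle : ∀ x, ρ x ≤ 1 + δ := fun x => by
    refine (b.normed_le_div_measure_closedBall_rIn volume x).trans ?_
    rw [Measure.real, Real.volume_closedBall, ENNReal.toReal_ofReal (by positivity)]
    change 1 / (2 * r) ≤ 1 + δ
    rw [hr]
    field_simp
    rfl
  have hρz : ∀ x, x ∉ Metric.ball (1 / 2 : ℝ) ((r + 1 / 2) / 2) → ρ x = 0 := fun x hx => by
    have h1 : x ∉ Function.support (b.normed volume) := by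
      rw [b.support_normed_eq]
      exact hx
    simpa using h1
  set κ : ℝ := (1 / 2 - r) / 2 with hκ
  have hκ0 : 0 < κ := by rw [hκ]; linarith
  have hzl : ∀ x ≤ κ, ρ x = 0 := fun x hx => hρz x fun h => by
    rw [Metric.mem_ball, Real.dist_eq, abs_lt] at h
    linarith [h.1]
  have hzr : ∀ x, 1 ≤ x → ρ x = 0 := fun x hx => hρz x fun h => by
    rw [Metric.mem_ball, Real.dist_eq, abs_lt] at h
    linarith [h.2]
  have hd : deriv (fun t => ∫ s in (0 : ℝ)..t, ρ s) = ρ := by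
    ext t
    exact hρs.continuous.deriv_integral ρ 0 t
  have hdiff : Differentiable ℝ fun t => ∫ s in (0 : ℝ)..t, ρ s := fun t =>
    (hρs.continuous.integral_hasStrictDerivAt 0 t).hasDerivAt.differentiableAt
  have hzero : ∀ s ≤ κ, ∫ x in (0 : ℝ)..s, ρ x = 0 := fun s hs => by
    apply intervalIntegral.integral_zero_ae
    refine Eventually.of_forall fun x hx => hzl x ?_
    rcases le_total 0 s with h | h
    · rw [uIoc_of_le h] at hx; exact hx.2.trans hs
    · rw [uIoc_of_ge h] at hx; exact hx.2.trans hκ0.le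
  refine ⟨fun t => ∫ s in (0 : ℝ)..t, ρ s, ?_, fun s => ?_, fun s hs => ?_, ⟨κ, hκ0, hzero⟩, ?_⟩
  · rw [contDiff_infty_iff_deriv, hd]
    exact ⟨hdiff, hρs⟩
  · change 0 ≤ ∫ x in (0 : ℝ)..s, ρ x ∧ ∫ x in (0 : ℝ)..s, ρ x ≤ 1
    rcases le_total s 0 with h | h
    · rw [hzero s (h.trans hκ0.le)]
      exact ⟨le_rfl, zero_le_one⟩
    · refine ⟨intervalIntegral.integral_nonneg h fun x _ => hρ0 x, ?_⟩
      rw [intervalIntegral.integral_of_le h, ← hρ1]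
      exact setIntegral_le_integral hρi (Eventually.of_forall hρ0)
  · change ∫ x in (0 : ℝ)..s, ρ x = 1
    rw [intervalIntegral.integral_of_le (zero_le_one.trans hs),
      setIntegral_eq_integral_of_forall_compl_eq_zero fun x hx => ?_, hρ1]
    by_contra hne
    refine hx ⟨?_, ?_⟩
    · by_contra h
      exact hne (hzl x ((not_lt.1 h).trans hκ0.le))
    · by_contra h
      exact hne (hzr x (hs.trans (not_le.1 h).le))
  · refine lipschitzWith_of_nnnorm_deriv_le hdiff fun x => ?_
    rw [hd, ← NNReal.coe_le_coe, coe_nnnorm, Real.coe_toNNReal _ (by positivity),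
      Real.norm_eq_abs, abs_of_nonneg (hρ0 x)]
    exact hρle x

/-- Smooth radial cutoffs vanishing near the centre and equal to one outside a ball, with nearly
optimal gradient bound. -/
lemma exists_radial_cutoff (N : ℕ) {δ : ℝ} (hδ : 0 < δ) :
    ∃ κ : ℝ, 0 < κ ∧ ∀ (c : Space N) (R : ℝ), 0 < R → ∃ θ : Space N → ℝ, IsMultiplier θ ∧
      (∀ x, 0 ≤ θ x ∧ θ x ≤ 1) ∧ (∀ x, R ≤ dist x c → θ x = 1) ∧
      (∀ x, dist x c ≤ κ * R → θ x = 0) ∧ ∀ x, ‖fderiv ℝ θ x‖ ≤ (1 + δ) / R := by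
  obtain ⟨h, hs, h01, h1, ⟨κ, hκ, h0⟩, hl⟩ := exists_smooth_step hδ
  refine ⟨κ, hκ, fun c R hR => ?_⟩
  have hfd : ∀ x, ‖fderiv ℝ (fun x : Space N => h (dist x c / R)) x‖ ≤ (1 + δ) / R := by
    intro x
    have hlip : LipschitzWith (Real.toNNReal ((1 + δ) / R))
        (fun x : Space N => h (dist x c / R)) := LipschitzWith.of_dist_le_mul fun x y => by
      refine (hl.dist_le_mul _ _).trans ?_
      rw [Real.coe_toNNReal _ (by positivity), Real.coe_toNNReal _ (by positivity), Real.dist_eq,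
        ← sub_div, abs_div, abs_of_pos hR]
      have := abs_dist_sub_le x y c
      calc (1 + δ) * (|dist x c - dist y c| / R) ≤ (1 + δ) * (dist x y / R) := by gcongr
        _ = _ := by ring
    have := norm_fderiv_le_of_lipschitz ℝ hlip (x₀ := x)
    rwa [Real.coe_toNNReal _ (by positivity)] at this
  refine ⟨fun x => h (dist x c / R), ⟨?_, ⟨1, fun x => ?_⟩, ⟨_, hfd⟩⟩, fun x => h01 _,
    fun x hx => h1 _ ((one_le_div hR).2 hx), fun x hx => h0 _ ((div_le_iff₀ hR).2 hx), hfd⟩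
  · rw [contDiff_iff_contDiffAt]
    intro x
    rcases eq_or_ne x c with rfl | hne
    · have : (fun y : Space N => h (dist y x / R)) =ᶠ[𝓝 x] fun _ => 0 := by
        filter_upwards [Metric.ball_mem_nhds x (mul_pos hκ hR)] with y hy
        exact h0 _ ((div_le_iff₀ hR).2 (Metric.mem_ball.1 hy).le)
      exact contDiffAt_const.congr_of_eventuallyEq this
    · exact hs.contDiffAt.comp x ((contDiffAt_id.dist ℝ contDiffAt_const hne).div_const R)
  · rw [abs_of_nonneg (h01 _).1]
    exact (h01 _).2

end Cutoff

section Mass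

variable {N : ℕ} {Ω : Set (Space N)}

lemma norm_sq_eq_integral (w : L2 Ω) : ‖w‖ ^ 2 = ∫ x in Ω, ‖w x‖ ^ 2 := by
  have h := congrArg Complex.re (L2.inner_def (𝕜 := ℂ) w w)
  rw [inner_self_eq_norm_sq_to_K] at h
  have e : ∀ x, inner ℂ (w x) (w x) = ((‖w x‖ ^ 2 : ℝ) : ℂ) := fun x => by
    rw [inner_self_eq_norm_sq_to_K]
    norm_cast
  simp_rw [e, integral_complex_ofReal] at h
  exact_mod_cast h

lemma re_inner_mulL2 {a : Space N → ℝ} (ha : IsMultiplier a) (w : L2 Ω) :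
    (inner ℂ (mulL2 Ω ha w) w).re = ∫ x in Ω, a x * ‖w x‖ ^ 2 := by
  rw [L2.inner_def]
  have e : (fun x => inner ℂ ((mulL2 Ω ha w : Space N → ℂ) x) (w x)) =ᵐ[volume.restrict Ω]
      fun x => ((a x * ‖w x‖ ^ 2 : ℝ) : ℂ) := by
    filter_upwards [coeFn_mulL2 ha w] with x hx
    rw [hx, RCLike.inner_apply, map_mul, Complex.conj_ofReal, mul_left_comm, Complex.mul_conj,
      Complex.normSq_eq_norm_sq]
    push_cast
    rfl
  rw [integral_congr_ae e, integral_complex_ofReal, Complex.ofReal_re]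

lemma integrable_norm_sq (w : L2 Ω) : Integrable (fun x => ‖w x‖ ^ 2) (volume.restrict Ω) :=
  (Lp.memLp w).integrable_norm_pow (by norm_num)

lemma IsMultiplier.integrable_mul_norm_sq {a : Space N → ℝ} (ha : IsMultiplier a) (w : L2 Ω) :
    Integrable (fun x => a x * ‖w x‖ ^ 2) (volume.restrict Ω) := by
  obtain ⟨C, hC⟩ := ha.bounded
  exact (integrable_norm_sq w).bdd_mul (c := C) ha.smooth.continuous.aestronglyMeasurable
    (Eventually.of_forall hC)

lemma norm_sq_sub_le_setIntegral {θ : Space N → ℝ} (hθ : IsMultiplier θ)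
    (h0 : ∀ x, 0 ≤ θ x) {S : Set (Space N)} (hS : MeasurableSet S)
    (h1 : ∀ x, x ∉ S → θ x = 1) (w : L2 Ω) :
    ‖w‖ ^ 2 - (inner ℂ (mulL2 Ω hθ w) w).re ≤ ∫ x in Ω ∩ S, ‖w x‖ ^ 2 := by
  rw [re_inner_mulL2, norm_sq_eq_integral, ← integral_sub (integrable_norm_sq w)
    (hθ.integrable_mul_norm_sq w), ← setIntegral_indicator hS]
  refine integral_mono ((integrable_norm_sq w).sub (hθ.integrable_mul_norm_sq w))
    ((integrable_norm_sq w).indicator hS) fun x => ?_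
  by_cases hx : x ∈ S
  · simp only [indicator_of_mem hx]
    nlinarith [h0 x, sq_nonneg ‖w x‖]
  · simp [indicator_of_notMem hx, h1 x hx]

lemma ofReal_le_eLpNorm_two {w : L2 Ω} {S : Set (Space N)} {η : ℝ}
    (h : η ^ 2 ≤ ∫ x in Ω ∩ S, ‖w x‖ ^ 2) :
    ENNReal.ofReal η ≤ eLpNorm w 2 (volume.restrict (Ω ∩ S)) := by
  have hw : MemLp w 2 (volume.restrict (Ω ∩ S)) :=
    (Lp.memLp w).mono_measure (Measure.restrict_mono inter_subset_left le_rfl)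
  rw [hw.eLpNorm_eq_integral_rpow_norm (by norm_num) (by norm_num)]
  apply ENNReal.ofReal_le_ofReal
  simp only [ENNReal.toReal_ofNat, Real.rpow_two, inv_eq_one_div]
  rw [← Real.sqrt_eq_rpow]
  exact Real.le_sqrt_of_sq_le h

lemma tendsto_setIntegral_dist_gt (w : L2 Ω) (c : Space N) {κ : ℝ} (hκ : 0 < κ) :
    Tendsto (fun R : ℝ => ∫ x in Ω ∩ {x | κ * R < dist x c}, ‖w x‖ ^ 2) atTop (𝓝 0) := by
  have hm : ∀ R : ℝ, MeasurableSet {x : Space N | κ * R < dist x c} := fun R =>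
    (isOpen_lt continuous_const (continuous_id.dist continuous_const)).measurableSet
  have h := tendsto_integral_filter_of_dominated_convergence (μ := volume.restrict Ω)
    (l := (atTop : Filter ℝ))
    (F := fun R x => indicator {x : Space N | κ * R < dist x c} (fun x => ‖w x‖ ^ 2) x)
    (f := fun _ => 0) (fun x => ‖w x‖ ^ 2)
    (Eventually.of_forall fun R => ((integrable_norm_sq w).indicator (hm R)).1)
    (Eventually.of_forall fun R => Eventually.of_forall fun x => by
      refine (norm_indicator_le_norm_self _ _).trans ?_
      rw [Real.norm_of_nonneg (by positivity)])
    (integrable_norm_sq w) (Eventually.of_forall fun x => by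
      refine tendsto_const_nhds.congr' ?_
      filter_upwards [eventually_gt_atTop (dist x c / κ)] with R hR
      rw [indicator_of_notMem]
      simp only [mem_ofPred_eq, not_lt]
      rw [div_lt_iff₀ hκ] at hR
      linarith)
  rw [integral_zero] at h
  refine h.congr fun R => ?_
  rw [setIntegral_indicator (hm R)]

lemma re_inner_mulL2_le_setIntegral {θ : Space N → ℝ} (hθ : IsMultiplier θ)
    (h1 : ∀ x, θ x ≤ 1) {S : Set (Space N)} (hS : MeasurableSet S)
    (h0 : ∀ x, x ∉ S → θ x = 0) (w : L2 Ω) :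
    (inner ℂ (mulL2 Ω hθ w) w).re ≤ ∫ x in Ω ∩ S, ‖w x‖ ^ 2 := by
  rw [re_inner_mulL2, ← setIntegral_indicator hS]
  refine integral_mono (hθ.integrable_mul_norm_sq w)
    ((integrable_norm_sq w).indicator hS) fun x => ?_
  by_cases hx : x ∈ S
  · simp only [indicator_of_mem hx]
    nlinarith [h1 x, sq_nonneg ‖w x‖]
  · simp [indicator_of_notMem hx, h0 x hx]

end Mass

section Hoelder

variable {N : ℕ} {Ω : Set (Space N)}

lemma expo_nonneg {r : ℝ≥0∞} (hr : 2 ≤ r) : 0 ≤ expo r := by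
  have h1 : r⁻¹ ≤ 2⁻¹ := ENNReal.inv_le_inv.2 hr
  have h2 := ENNReal.toReal_mono (by norm_num) h1
  rw [expo]
  norm_num at h2 ⊢
  linarith

/-- An `L²` lower bound on a ball of radius `M t` gives an `L^r` lower bound. -/
lemma ofReal_mul_rpow_le_of_le_eLpNorm_two {w : L2 Ω} {c : Space N} {M t η : ℝ} (hM : 0 < M)
    (ht : 0 < t) {r : ℝ≥0∞} (hr : 2 ≤ r)
    (h : ENNReal.ofReal η ≤ eLpNorm w 2 (volume.restrict (Ω ∩ {x | dist x c < M * |t|}))) :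
    ENNReal.ofReal η * volume (Metric.ball (0 : Space N) M) ^ (-expo r) ≤
      ENNReal.ofReal (|t| ^ ((N : ℝ) * expo r)) *
        eLpNorm w r (volume.restrict (Ω ∩ {x | dist x c < M * |t|})) := by
  have he := expo_nonneg hr
  rw [abs_of_pos ht] at h ⊢
  set V := volume (Metric.ball (0 : Space N) M) with hV
  set μ := volume.restrict (Ω ∩ {x | dist x c < M * t}) with hμ
  have hV0 : V ≠ 0 := (Metric.measure_ball_pos volume _ hM).ne'
  have hVt : V ≠ ⊤ := measure_ball_lt_top.ne
  have hw : AEStronglyMeasurable w μ :=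
    (Lp.aestronglyMeasurable w).mono_measure (Measure.restrict_mono inter_subset_left le_rfl)
  have h1 := eLpNorm_le_eLpNorm_mul_rpow_measure_univ hr hw
  have hexp : 1 / (2 : ℝ≥0∞).toReal - 1 / r.toReal = expo r := by
    rw [expo, ENNReal.toReal_inv]
    simp
  rw [hexp] at h1
  have h2 : μ univ ≤ ENNReal.ofReal (t ^ N) * V := by
    rw [hμ, Measure.restrict_apply_univ]
    refine (measure_mono inter_subset_right).trans ?_
    have h3 := Measure.addHaar_ball_mul_of_pos (volume : Measure (Space N)) c ht M
    rw [finrank_euclideanSpace_fin] at h3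
    rw [← h3, mul_comm]
    rfl
  have h4 : (ENNReal.ofReal (t ^ N) * V) ^ expo r =
      ENNReal.ofReal (t ^ ((N : ℝ) * expo r)) * V ^ expo r := by
    rw [ENNReal.mul_rpow_of_nonneg _ _ he, ENNReal.ofReal_rpow_of_pos (by positivity),
      Real.rpow_mul ht.le, Real.rpow_natCast]
  have hVe0 : V ^ expo r ≠ 0 := (ENNReal.rpow_pos (pos_iff_ne_zero.2 hV0) hVt).ne'
  have hVet : V ^ expo r ≠ ⊤ := ENNReal.rpow_ne_top_of_nonneg he hVt
  rw [ENNReal.rpow_neg, ← div_eq_mul_inv]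
  refine ENNReal.div_le_of_le_mul ?_
  calc ENNReal.ofReal η ≤ eLpNorm w r μ * μ univ ^ expo r := h.trans h1
    _ ≤ eLpNorm w r μ * (ENNReal.ofReal (t ^ N) * V) ^ expo r := by gcongr
    _ = _ := by rw [h4]; ring

end Hoelder

section EssentiallyBounded

variable {H : Type*} [NormedAddCommGroup H] [NormedSpace ℝ H]

lemma memLp_dual_mono {F : ℝ → StrongDual ℝ H} {μ ν : Measure ℝ} (hF : MemLp F ∞ ν)
    (hμ : μ ≤ ν) : MemLp F ∞ μ := hF.mono_measure hμ

lemma memLp_dual_comp {F : ℝ → StrongDual ℝ H} {μ ν : Measure ℝ} (hF : MemLp F ∞ ν) {g : ℝ → ℝ}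
    (hg : MeasurePreserving g μ ν) : MemLp (fun t => F (g t)) ∞ μ :=
  hF.comp_measurePreserving hg

end EssentiallyBounded

section AbstractEvolution

variable {H L M : Type*} [NormedAddCommGroup H] [InnerProductSpace ℂ H]
  [NormedSpace ℝ H] [IsScalarTower ℝ ℂ H]
  [NormedAddCommGroup L] [InnerProductSpace ℂ L] [NormedAddCommGroup M] [InnerProductSpace ℂ M]

/-- The functional `φ ↦ - Re ⟨B x, B φ⟩ + F(x) φ`. -/
noncomputable def forceTerm (B : H →L[ℂ] M) (F : H → StrongDual ℝ H) (x : H) : StrongDual ℝ H :=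
  - dualEmb B (B x) + F x

lemma forceTerm_apply (B : H →L[ℂ] M) (F : H → StrongDual ℝ H) (x φ : H) :
    forceTerm B F x φ = - (inner ℂ (B x) (B φ)).re + F x φ := rfl

lemma forceTerm_apply' (B : H →L[ℂ] M) (F : H → StrongDual ℝ H) (x φ : H) :
    forceTerm B F x φ = - (inner ℂ (B φ) (B x)).re + F x φ := by
  rw [forceTerm_apply, ← inner_conj_symm, Complex.conj_re]

lemma dualEmb_apply' (A : H →L[ℂ] L) (y : L) (φ : H) :
    dualEmb A y φ = (inner ℂ (A φ) y).re := by
  rw [dualEmb_apply, ← inner_conj_symm, Complex.conj_re]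

lemma memLp_dualEmb {B : H →L[ℂ] M} {v : ℝ → H} {μ : Measure ℝ} (hv : MemLp v ∞ μ) :
    MemLp (fun t => dualEmb B (B (v t))) ∞ μ := by
  have hc : Continuous fun x : H => dualEmb B (B x) := (continuous_dualEmb B).comp B.continuous
  have hm : AEStronglyMeasurable (fun t => dualEmb B (B (v t))) μ :=
    hc.comp_aestronglyMeasurable hv.1
  refine hv.of_le_mul (c := ‖B‖ * ‖B‖) hm (Eventually.of_forall fun t => ?_)
  calc ‖dualEmb B (B (v t))‖ ≤ ‖B‖ * ‖B (v t)‖ := norm_dualEmb_le _ _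
    _ ≤ ‖B‖ * (‖B‖ * ‖v t‖) := by gcongr; exact B.le_opNorm (v t)
    _ = _ := by ring

lemma memLp_forceTerm {B : H →L[ℂ] M} {F : H → StrongDual ℝ H} {v : ℝ → H} {μ : Measure ℝ}
    (hv : MemLp v ∞ μ) (hF : MemLp (fun t => F (v t)) ∞ μ) :
    MemLp (fun t => forceTerm B F (v t)) ∞ μ := by
  have h := hF.sub (memLp_dualEmb (B := B) hv)
  have e : (fun t => forceTerm B F (v t)) = (fun t => F (v t)) - fun t => dualEmb B (B (v t)) := by
    ext t φ
    simp [forceTerm, neg_add_eq_sub]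
  rw [e]
  exact h

/-- Solutions on `(0, ∞)` of `σ i v_t - B*B v + F(v) = 0`, `v(0) = y₀`; the sign `σ = -1` occurs
after time reversal. -/
structure IsSignedSolution (A : H →L[ℂ] L) (B : H →L[ℂ] M) (F : H → StrongDual ℝ H) (σ : ℝ)
    (y₀ : L) (v : ℝ → H) : Prop where
  bounded : MemLp v ∞ (volume.restrict (Ioi (0 : ℝ)))
  nonlin_bounded : ∀ T : ℝ, 0 < T → MemLp (fun t => F (v t)) ∞ (volume.restrict (Ioo 0 T))
  equation : ∀ φ : H, ∀ ψ : ℝ → ℝ, IsTest (Ioi (0 : ℝ)) ψ →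
    ∫ t in Ioi (0 : ℝ), (- (σ * (inner ℂ (A φ) (Complex.I • A (v t))).re) * deriv ψ t
      + (- (inner ℂ (B φ) (B (v t))).re + F (v t) φ) * ψ t) = 0
  initial : Tendsto (fun t => A (v t)) (𝓝 0 ⊓ ae (volume.restrict (Ioi (0 : ℝ)))) (𝓝 y₀)

variable {A : H →L[ℂ] L} {B : H →L[ℂ] M} {F : H → StrongDual ℝ H} {σ : ℝ} {y₀ : L} {v : ℝ → H}

lemma IsSignedSolution.isWeakSolution (h : IsSignedSolution A B F σ y₀ v) :
    IsWeakSolution A σ y₀ v fun t => forceTerm B F (v t) where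
  bounded := h.bounded
  force T hT := memLp_forceTerm (h.bounded.mono_measure
    (Measure.restrict_mono Ioo_subset_Ioi_self le_rfl)) (h.nonlin_bounded T hT)
  equation φ ψ hψ := by
    simp_rw [forceTerm_apply', dualEmb_apply']
    exact h.equation φ ψ hψ
  initial := h.initial

end AbstractEvolution

section Forward

variable {N : ℕ} {Ω : Set (Space N)} {f : H10 Ω → Hneg1 Ω} {u₀ : H10 Ω} {σ : ℝ} {v : ℝ → H10 Ω}

lemma ae_norm_grad_le_gradSup {I : Set ℝ} (hv : MemLp v ∞ (volume.restrict I)) :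
    ∀ᵐ t ∂(volume.restrict I), ‖grad (v t)‖ ≤ gradSup I v := by
  have h1 : MemLp (fun t => grad (v t)) ∞ (volume.restrict I) := (gradL Ω).comp_memLp' hv
  have h2 := h1.2.ne
  filter_upwards [ae_le_eLpNormEssSup (f := fun t => grad (v t)) (μ := volume.restrict I)]
    with t ht
  rw [gradSup, ← toReal_enorm]
  exact ENNReal.toReal_mono h2 (by simpa [eLpNorm_exponent_top] using ht)

lemma abs_force_le (hf : IsGaugeOrthogonal f) {a : Space N → ℝ} (ha : IsMultiplier a) {C : ℝ}
    (hC : ∀ x, ‖fderiv ℝ a x‖ ≤ C) (v : H10 Ω) :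
    |forceTerm (gradL Ω) f v (Complex.I • mulH10 Ω ha v)| ≤ C * ‖toL2 v‖ * ‖grad v‖ := by
  have h1 : f v (Complex.I • mulH10 Ω ha v) = 0 := by
    refine hf a (ha.memW1inf Ω) v _ ?_
    change (Complex.I • mulL2 Ω ha (toL2 v) : L2 Ω) =ᵐ[volume.restrict Ω] _
    filter_upwards [Lp.coeFn_smul Complex.I (mulL2 Ω ha (toL2 v)), coeFn_mulL2 ha (toL2 v)]
      with x h2 h3
    rw [h2, Pi.smul_apply, h3, smul_eq_mul, mul_assoc]
  have h2 : - (inner ℂ (grad v) (grad (Complex.I • mulH10 Ω ha v))).re =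
      (inner ℂ (grad v) (mulGrad Ω ha (toL2 v))).im := by
    have e : grad (Complex.I • mulH10 Ω ha v) =
        Complex.I • (mulL2vec Ω ha (grad v) + mulGrad Ω ha (toL2 v)) := rfl
    have e2 : (inner ℂ (grad v) (mulL2vec Ω ha (grad v))).im = 0 := by
      rw [← inner_conj_symm, Complex.conj_im, inner_mulL2vec_self_im, neg_zero]
    rw [e, inner_smul_right, inner_add_right, Complex.I_mul_re, neg_neg, Complex.add_im,
      e2, zero_add]
  rw [forceTerm_apply, gradL_apply, gradL_apply, h1, h2, add_zero]
  refine (Complex.abs_im_le_norm _).trans ((norm_inner_le_norm _ _).trans ?_)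
  rw [mul_comm]
  gcongr
  exact norm_mulGrad_le ha hC _

lemma isMultiplier_one : IsMultiplier fun _ : Space N => (1 : ℝ) :=
  ⟨contDiff_const, ⟨1, by simp⟩, ⟨0, by simp⟩⟩

lemma mulL2_one (w : L2 Ω) : mulL2 Ω isMultiplier_one w = w := by
  apply Lp.ext
  filter_upwards [coeFn_mulL2 isMultiplier_one w] with x hx
  rw [hx]
  simp

section Estimates

variable {U : ℝ → L2 Ω}

lemma IsSignedSolution.apply_zero (h : IsSignedSolution (toL2L Ω) (gradL Ω) f σ (toL2 u₀) v) (hU : IsContRep (Ioi 0) v U) :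
    U 0 = toL2 u₀ :=
  eq_of_continuousOn_of_tendsto (closure_Ioi (0 : ℝ) ▸ hU.1) hU.2 h.initial

/-- Conservation of the `L²` norm. -/
lemma IsSignedSolution.norm_eq (h : IsSignedSolution (toL2L Ω) (gradL Ω) f σ (toL2 u₀) v) (hσ : σ * σ = 1)
    (hΩ : IsOpen Ω) (hf : IsGaugeOrthogonal f) (hU : IsContRep (Ioi 0) v U) {T : ℝ} (hT : 0 < T) :
    ‖U T‖ = ‖toL2 u₀‖ := by
  have key := h.isWeakSolution.abs_quadratic_sub_le hσ (toL2L_injective hΩ)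
    (mulH10 Ω isMultiplier_one) (mulL2 Ω isMultiplier_one) (fun _ => rfl)
    (fun x y => inner_mulL2 _ x y) (B := 0) (Eventually.of_forall fun t => by
      simpa using abs_force_le hf isMultiplier_one (C := 0) (fun x => by simp) (v t))
    (closure_Ioi (0 : ℝ) ▸ hU.1) hU.2 hT
  rw [mul_zero, zero_mul, mulL2_one, mulL2_one, h.apply_zero hU] at key
  have e : ∀ w : L2 Ω, (inner ℂ w w).re = ‖w‖ ^ 2 := fun w => by
    rw [inner_self_eq_norm_sq_to_K]
    norm_cast
  rw [e, e] at key
  have h1 := sub_eq_zero.1 (abs_nonpos_iff.1 key)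
  exact (sq_eq_sq₀ (norm_nonneg _) (norm_nonneg _)).1 h1

lemma IsSignedSolution.ae_norm_eq (h : IsSignedSolution (toL2L Ω) (gradL Ω) f σ (toL2 u₀) v) (hσ : σ * σ = 1)
    (hΩ : IsOpen Ω) (hf : IsGaugeOrthogonal f) (hU : IsContRep (Ioi 0) v U) :
    ∀ᵐ t ∂(volume.restrict (Ioi (0 : ℝ))), ‖toL2 (v t)‖ = ‖toL2 u₀‖ := by
  filter_upwards [hU.2, ae_restrict_mem measurableSet_Ioi] with t h1 h2
  rw [← h1, h.norm_eq hσ hΩ hf hU h2]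

/-- The growth of localized masses. -/
lemma IsSignedSolution.re_inner_mulL2_le (h : IsSignedSolution (toL2L Ω) (gradL Ω) f σ (toL2 u₀) v) (hσ : σ * σ = 1)
    (hΩ : IsOpen Ω) (hf : IsGaugeOrthogonal f) (hU : IsContRep (Ioi 0) v U)
    {a : Space N → ℝ} (ha : IsMultiplier a) {C : ℝ} (hC : ∀ x, ‖fderiv ℝ a x‖ ≤ C) {T : ℝ}
    (hT : 0 < T) : (inner ℂ (mulL2 Ω ha (U T)) (U T)).re ≤
      (inner ℂ (mulL2 Ω ha (toL2 u₀)) (toL2 u₀)).re +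
        2 * (C * ‖toL2 u₀‖ * gradSup (Ioi 0) v) * T := by
  have hC0 : 0 ≤ C := (norm_nonneg _).trans (hC 0)
  have key := h.isWeakSolution.abs_quadratic_sub_le hσ (toL2L_injective hΩ)
    (mulH10 Ω ha) (mulL2 Ω ha) (fun _ => rfl)
    (fun x y => inner_mulL2 _ x y) (B := C * ‖toL2 u₀‖ * gradSup (Ioi 0) v) (by
      filter_upwards [h.ae_norm_eq hσ hΩ hf hU, ae_norm_grad_le_gradSup h.bounded] with t h1 h2
      refine (abs_force_le hf ha hC (v t)).trans ?_
      rw [h1]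
      gcongr)
    (closure_Ioi (0 : ℝ) ▸ hU.1) hU.2 hT
  rw [h.apply_zero hU] at key
  linarith [le_abs_self ((inner ℂ (mulL2 Ω ha (U T)) (U T)).re -
    (inner ℂ (mulL2 Ω ha (toL2 u₀)) (toL2 u₀)).re)]

lemma IsSignedSolution.gradSup_pos (h : IsSignedSolution (toL2L Ω) (gradL Ω) f σ (toL2 u₀) v) (hσ : σ * σ = 1)
    (hN : 1 ≤ N) (hΩ : IsOpen Ω) (hf : IsGaugeOrthogonal f) (hU : IsContRep (Ioi 0) v U)
    (h0 : 0 < ‖toL2 u₀‖) : 0 < gradSup (Ioi 0) v := by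
  by_contra hcon
  have hne : (ae (volume.restrict (Ioi (0 : ℝ)))).NeBot := by
    rw [ae_neBot, Ne, Measure.restrict_eq_zero]
    simp
  obtain ⟨t, h1, h2⟩ := ((h.ae_norm_eq hσ hΩ hf hU).and (ae_norm_grad_le_gradSup h.bounded)).exists
  have h3 : grad (v t) = 0 := norm_le_zero_iff.1 (h2.trans (not_lt.1 hcon))
  rw [toL2_eq_zero_of_grad_eq_zero hN h3, norm_zero] at h1
  exact h0.ne h1

lemma M0_pos {I : Set ℝ} {ε : ℝ} (hε : 0 < ε) (hε' : ε < ‖toL2 u₀‖) (hK : 0 < gradSup I v) :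
    0 < M0 u₀ I v ε := by
  have h1 : 0 < ‖toL2 u₀‖ := hε.trans hε'
  have h2 : 0 < ‖toL2 u₀‖ ^ 2 - ε ^ 2 := sub_pos.2 (pow_lt_pow_left₀ hε' hε.le two_ne_zero)
  rw [M0]
  positivity

/-- The mass that stays in the ball of radius `M₀ t`. -/
lemma IsSignedSolution.eventually_le_eLpNorm_two (h : IsSignedSolution (toL2L Ω) (gradL Ω) f σ (toL2 u₀) v) (hσ : σ * σ = 1)
    (hN : 1 ≤ N) (hΩ : IsOpen Ω) (hf : IsGaugeOrthogonal f) (hU : IsContRep (Ioi 0) v U)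
    {ε : ℝ} (hε : 0 < ε) (hε' : ε < ‖toL2 u₀‖) (c : Space N) {η : ℝ} (hη : 0 < η) (hηε : η < ε) :
    ∀ᶠ t : ℝ in atTop, ENNReal.ofReal η ≤
      eLpNorm (U t) 2 (volume.restrict (Ω ∩ {x | dist x c < M0 u₀ (Ioi 0) v ε * |t|})) := by
  have h0 : 0 < ‖toL2 u₀‖ := hε.trans hε'
  have hK := h.gradSup_pos hσ hN hΩ hf hU h0
  have hM := M0_pos (I := Ioi 0) hε hε' hK
  have hD : 0 < ‖toL2 u₀‖ ^ 2 - ε ^ 2 := sub_pos.2 (pow_lt_pow_left₀ hε' hε.le two_ne_zero)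
  have hg : 0 < ε ^ 2 - η ^ 2 := sub_pos.2 (pow_lt_pow_left₀ hηε hη.le two_ne_zero)
  set M := M0 u₀ (Ioi 0) v ε with hMdef
  have hMe : 2 * ‖toL2 u₀‖ * gradSup (Ioi 0) v = M * (‖toL2 u₀‖ ^ 2 - ε ^ 2) := by
    rw [hMdef, M0]
    field_simp
  set δ := (ε ^ 2 - η ^ 2) / (2 * (‖toL2 u₀‖ ^ 2 - ε ^ 2)) with hδ
  have hδ0 : 0 < δ := by positivity
  have hδD : δ * (‖toL2 u₀‖ ^ 2 - ε ^ 2) = (ε ^ 2 - η ^ 2) / 2 := by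
    rw [hδ]
    field_simp
  obtain ⟨κ, hκ, hcut⟩ := exists_radial_cutoff N hδ0
  have hlim := (tendsto_setIntegral_dist_gt (toL2 u₀) c hκ).comp
    (tendsto_id.const_mul_atTop hM)
  filter_upwards [hlim.eventually (gt_mem_nhds (half_pos hg)), eventually_gt_atTop 0] with t h1 ht
  rw [abs_of_pos ht]
  have hR : 0 < M * t := mul_pos hM ht
  obtain ⟨θ, hθ, hθ01, hθ1, hθ0, hθd⟩ := hcut c (M * t) hR
  refine ofReal_le_eLpNorm_two ?_
  have e1 := norm_sq_sub_le_setIntegral hθ (fun x => (hθ01 x).1)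
    (S := {x | dist x c < M * t})
    (isOpen_lt (continuous_id.dist continuous_const) continuous_const).measurableSet
    (fun x hx => hθ1 x (not_lt.1 hx)) (U t)
  have e2 := h.re_inner_mulL2_le hσ hΩ hf hU hθ hθd ht
  have e3 := re_inner_mulL2_le_setIntegral hθ (fun x => (hθ01 x).2)
    (S := {x | κ * (M * t) < dist x c})
    (isOpen_lt continuous_const (continuous_id.dist continuous_const)).measurableSet
    (fun x hx => hθ0 x (not_lt.1 hx)) (toL2 u₀)
  have e4 : 2 * ((1 + δ) / (M * t) * ‖toL2 u₀‖ * gradSup (Ioi 0) v) * t =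
      (1 + δ) * (‖toL2 u₀‖ ^ 2 - ε ^ 2) := by
    have : 2 * ((1 + δ) / (M * t) * ‖toL2 u₀‖ * gradSup (Ioi 0) v) * t =
      (1 + δ) / (M * t) * (2 * ‖toL2 u₀‖ * gradSup (Ioi 0) v) * t := by ring
    rw [this, hMe]
    field_simp
  rw [h.norm_eq hσ hΩ hf hU ht] at e1
  simp only [Function.comp_apply, id_eq] at h1
  rw [e4, add_mul, one_mul, hδD] at e2
  linarith

end Estimates

/-- The statement for solutions on `(0, ∞)`, with an arbitrary sign in front of `i v_t`. -/
theorem IsSignedSolution.lower_bound (h : IsSignedSolution (toL2L Ω) (gradL Ω) f σ (toL2 u₀) v) (hσ : σ * σ = 1)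
    (hN : 1 ≤ N) (hΩ : IsOpen Ω) (hf : IsGaugeOrthogonal f) :
    (∃ U : ℝ → L2 Ω, IsContRep (Ioi 0) v U) ∧
      ∀ U : ℝ → L2 Ω, IsContRep (Ioi 0) v U →
        U 0 = toL2 u₀ ∧
        ∀ ε : ℝ, 0 < ε → ε < ‖toL2 u₀‖ → ∀ r : ℝ≥0∞, 2 ≤ r → ∀ c ∈ Ω,
          0 < M0 u₀ (Ioi 0) v ε ∧
          ENNReal.ofReal ε *
              volume (Metric.ball (0 : Space N) (M0 u₀ (Ioi 0) v ε)) ^ (-expo r) ≤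
            liminf (fun t : ℝ => ENNReal.ofReal (|t| ^ ((N : ℝ) * expo r)) *
              eLpNorm (U t) r
                (volume.restrict (Ω ∩ {x | dist x c < M0 u₀ (Ioi 0) v ε * |t|}))) atTop := by
  refine ⟨?_, fun U hU => ⟨h.apply_zero hU, fun ε hε hε' r hr c _ => ?_⟩⟩
  · obtain ⟨U, h1, h2⟩ := h.isWeakSolution.exists_continuousOn hσ
    exact ⟨U, by rwa [closure_Ioi], h2⟩
  · have hM := M0_pos (I := Ioi 0) hε hε' (h.gradSup_pos hσ hN hΩ hf hU (hε.trans hε'))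
    refine ⟨hM, ?_⟩
    set V := volume (Metric.ball (0 : Space N) (M0 u₀ (Ioi 0) v ε)) with hV
    have hV0 : V ≠ 0 := (Metric.measure_ball_pos volume _ hM).ne'
    have hVt : V ≠ ⊤ := measure_ball_lt_top.ne
    have hVe : V ^ (-expo r) ≠ ⊤ := by
      rw [ENNReal.rpow_neg]
      exact ENNReal.inv_ne_top.2 (ENNReal.rpow_pos (pos_iff_ne_zero.2 hV0) hVt).ne'
    have hlim : Tendsto (fun η : ℝ => ENNReal.ofReal η * V ^ (-expo r)) (𝓝[<] ε)
        (𝓝 (ENNReal.ofReal ε * V ^ (-expo r))) :=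
      ENNReal.Tendsto.mul_const
        ((ENNReal.continuous_ofReal.tendsto ε).mono_left nhdsWithin_le_nhds) (Or.inr hVe)
    refine le_of_tendsto hlim ?_
    filter_upwards [Ioo_mem_nhdsLT hε] with η hη
    refine le_liminf_of_le (by isBoundedDefault) ?_
    filter_upwards [h.eventually_le_eLpNorm_two hσ hN hΩ hf hU hε hε' c hη.1 hη.2,
      eventually_gt_atTop 0] with t h1 h2
    exact ofReal_mul_rpow_le_of_le_eLpNorm_two hM h2 hr h1

end Forward

section TimeReversal

variable {N : ℕ} {Ω : Set (Space N)} {f : H10 Ω → Hneg1 Ω} {u₀ : H10 Ω} {u : ℝ → H10 Ω}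

lemma IsSolution.isSignedSolution (h : IsSolution f u₀ (Ioi 0) u) :
    IsSignedSolution (toL2L Ω) (gradL Ω) f 1 (toL2 u₀) u where
  bounded := h.bounded
  nonlin_bounded T hT := memLp_dual_mono (h.nonlin_bounded T hT)
    (Measure.restrict_mono (s := Ioo 0 T) (s' := Ioi 0 ∩ Ioo (-T) T)
      (fun t ht => ⟨ht.1, (neg_lt_zero.2 hT).trans ht.1, ht.2⟩) le_rfl)
  equation φ ψ hψ := by
    simp_rw [one_mul]
    exact h.equation φ ψ hψ
  initial := h.initial

lemma measurePreserving_neg_restrict {A B : Set ℝ} (hB : MeasurableSet B)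
    (hAB : (fun t : ℝ => -t) ⁻¹' B = A) :
    MeasurePreserving (fun t : ℝ => -t) (volume.restrict A) (volume.restrict B) := by
  rw [← hAB]
  exact (Measure.measurePreserving_neg (volume : Measure ℝ)).restrict_preimage hB

lemma measurePreserving_neg_Ioi_Iio :
    MeasurePreserving (fun t : ℝ => -t) (volume.restrict (Ioi 0)) (volume.restrict (Iio 0)) :=
  measurePreserving_neg_restrict measurableSet_Iio (by ext; simp)

lemma measurePreserving_neg_Iio_Ioi :
    MeasurePreserving (fun t : ℝ => -t) (volume.restrict (Iio 0)) (volume.restrict (Ioi 0)) :=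
  measurePreserving_neg_restrict measurableSet_Ioi (by ext; simp)

lemma tendsto_neg_nhds_inf_ae :
    Tendsto (fun t : ℝ => -t) (𝓝 0 ⊓ ae (volume.restrict (Ioi (0 : ℝ))))
      (𝓝 0 ⊓ ae (volume.restrict (Iio (0 : ℝ)))) := by
  refine Tendsto.inf ?_ measurePreserving_neg_Ioi_Iio.quasiMeasurePreserving.tendsto_ae
  simpa using (continuous_neg (G := ℝ)).tendsto 0

lemma IsTest.comp_neg {ψ : ℝ → ℝ} (hψ : IsTest (Ioi (0 : ℝ)) ψ) :
    IsTest (Iio (0 : ℝ)) fun t => ψ (-t) := by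
  have hts : tsupport (fun t => ψ (-t)) = (Homeomorph.neg ℝ) ⁻¹' tsupport ψ :=
    tsupport_comp_eq_preimage ψ (Homeomorph.neg ℝ)
  refine ⟨hψ.smooth.comp contDiff_neg, hψ.compact.comp_homeomorph (Homeomorph.neg ℝ), ?_⟩
  rw [hts]
  intro t ht
  have : 0 < -t := hψ.support ht
  exact neg_pos.1 this

lemma IsSolution.isSignedSolution_neg (h : IsSolution f u₀ (Iio 0) u) :
    IsSignedSolution (toL2L Ω) (gradL Ω) f (-1) (toL2 u₀) fun t => u (-t) where
  bounded := h.bounded.comp_measurePreserving measurePreserving_neg_Ioi_Iio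
  nonlin_bounded T hT := memLp_dual_comp (h.nonlin_bounded T hT)
    (measurePreserving_neg_restrict (measurableSet_Iio.inter measurableSet_Ioo) (by
      ext t
      simp only [mem_preimage, mem_inter_iff, mem_Iio, mem_Ioo]
      constructor
      · rintro ⟨h1, h2, h3⟩; constructor <;> linarith
      · rintro ⟨h1, h2⟩; refine ⟨?_, ?_, ?_⟩ <;> linarith))
  equation φ ψ hψ := by
    refine Eq.trans ?_ ((measurePreserving_neg_Ioi_Iio.integral_comp
      (Homeomorph.neg ℝ).measurableEmbedding _).trans (h.equation φ _ hψ.comp_neg))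
    refine integral_congr_ae (Eventually.of_forall fun t => ?_)
    simp only [deriv_comp_neg, neg_neg, pairL2, pairLaplacian, toL2L_apply, gradL_apply]
    ring
  initial := h.initial.comp tendsto_neg_nhds_inf_ae

lemma IsSolution.gradSup_neg (h : IsSolution f u₀ (Iio 0) u) :
    gradSup (Ioi 0) (fun t => u (-t)) = gradSup (Iio 0) u := by
  have h1 : MemLp (fun t => grad (u t)) ∞ (volume.restrict (Iio 0)) :=
    (gradL Ω).comp_memLp' h.bounded
  rw [gradSup, gradSup, ← eLpNorm_comp_measurePreserving h1.1 measurePreserving_neg_Ioi_Iio]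
  rfl

lemma isContRep_neg_iff {U : ℝ → L2 Ω} :
    IsContRep (Ioi 0) (fun t => u (-t)) (fun t => U (-t)) ↔ IsContRep (Iio 0) u U := by
  rw [IsContRep, IsContRep, closure_Ioi, closure_Iio]
  constructor
  · rintro ⟨h1, h2⟩
    refine ⟨?_, ?_⟩
    · have := h1.comp (continuous_neg.continuousOn (s := Iic (0 : ℝ))) (fun t ht => by
        simpa using ht)
      simpa [Function.comp_def] using this
    · have := measurePreserving_neg_Iio_Ioi.quasiMeasurePreserving.ae_eq_comp h2
      simpa [Function.comp_def] using this
  · rintro ⟨h1, h2⟩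
    refine ⟨h1.comp (continuous_neg.continuousOn (s := Ici (0 : ℝ))) (fun t ht => by
        simpa using ht), ?_⟩
    exact measurePreserving_neg_Ioi_Iio.quasiMeasurePreserving.ae_eq_comp h2

lemma liminf_atBot_eq {F : ℝ → ℝ≥0∞} : liminf F atBot = liminf (fun t => F (-t)) atTop := by
  rw [← map_neg_atTop]
  rfl

end TimeReversal

end NLS

theorem theorem2p1 (N : ℕ) (hN : 1 ≤ N) (Ω : Set (NLS.Space N)) (hΩ : IsOpen Ω)
    (f : NLS.H10 Ω → NLS.Hneg1 Ω) (hf : Continuous f) (hf' : NLS.IsGaugeOrthogonal f)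
    (u₀ : NLS.H10 Ω) (hu₀ : u₀ ≠ 0) :
    (∀ u : ℝ → NLS.H10 Ω, NLS.IsSolution f u₀ (Ioi 0) u →
      (∃ U : ℝ → NLS.L2 Ω, NLS.IsContRep (Ioi 0) u U) ∧
      ∀ U : ℝ → NLS.L2 Ω, NLS.IsContRep (Ioi 0) u U →
        U 0 = NLS.toL2 u₀ ∧
        ∀ ε : ℝ, 0 < ε → ε < ‖NLS.toL2 u₀‖ → ∀ r : ℝ≥0∞, 2 ≤ r → ∀ c ∈ Ω,
          0 < NLS.M0 u₀ (Ioi 0) u ε ∧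
          ENNReal.ofReal ε *
              volume (Metric.ball (0 : NLS.Space N) (NLS.M0 u₀ (Ioi 0) u ε)) ^ (-NLS.expo r) ≤
            liminf (fun t : ℝ => ENNReal.ofReal (|t| ^ ((N : ℝ) * NLS.expo r)) *
              eLpNorm (U t) r
                (volume.restrict (Ω ∩ {x | dist x c < NLS.M0 u₀ (Ioi 0) u ε * |t|}))) atTop) ∧
    (∀ u : ℝ → NLS.H10 Ω, NLS.IsSolution f u₀ (Iio 0) u →
      (∃ U : ℝ → NLS.L2 Ω, NLS.IsContRep (Iio 0) u U) ∧
      ∀ U : ℝ → NLS.L2 Ω, NLS.IsContRep (Iio 0) u U →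
        U 0 = NLS.toL2 u₀ ∧
        ∀ ε : ℝ, 0 < ε → ε < ‖NLS.toL2 u₀‖ → ∀ r : ℝ≥0∞, 2 ≤ r → ∀ c ∈ Ω,
          0 < NLS.M0 u₀ (Iio 0) u ε ∧
          ENNReal.ofReal ε *
              volume (Metric.ball (0 : NLS.Space N) (NLS.M0 u₀ (Iio 0) u ε)) ^ (-NLS.expo r) ≤
            liminf (fun t : ℝ => ENNReal.ofReal (|t| ^ ((N : ℝ) * NLS.expo r)) *
              eLpNorm (U t) r
                (volume.restrict (Ω ∩ {x | dist x c < NLS.M0 u₀ (Iio 0) u ε * |t|}))) atBot) := by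
  refine ⟨fun u hu => hu.isSignedSolution.lower_bound (by norm_num) hN hΩ hf', fun u hu => ?_⟩
  obtain ⟨⟨U, hU⟩, h⟩ := hu.isSignedSolution_neg.lower_bound (by norm_num) hN hΩ hf'
  have hM : ∀ ε, NLS.M0 u₀ (Ioi 0) (fun t => u (-t)) ε = NLS.M0 u₀ (Iio 0) u ε := fun ε => by
    rw [NLS.M0, NLS.M0, hu.gradSup_neg]
  refine ⟨⟨fun t => U (-t), NLS.isContRep_neg_iff.1 (by simpa using hU)⟩, fun V hV => ?_⟩
  obtain ⟨h0, hl⟩ := h _ (NLS.isContRep_neg_iff.2 hV)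
  refine ⟨by simpa using h0, fun ε hε hε' r hr c hc => ?_⟩
  have := hl ε hε hε' r hr c hc
  rw [hM] at this
  rw [NLS.liminf_atBot_eq]
  simpa only [abs_neg] using this
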